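/- **Setting.** Let $\Phi_s,\Phi_m$ be CNF formulas (finite lists of clauses; a clause is a finite set of literals, the empty clause is $\bot$), called the inputs of the secondary module $s$ and the main module $m$. A variable is *shared* if it occurs in both formulas, a clause is *shared* if all its variables are; all other variables are *local*. **Modular DRUP proofs.** A step is $(\mathrm{asserted},x,C)$, $(\mathrm{rup},x,C)$, $(\mathrm{cp}(x'),x,C)$ (copy $C$ from $x'$ to $x$) or $(\mathrm{del},x,C)$, with $x,x'\in\{s,m\}$. After a sequence of steps, a clause $C$ is *active* in $x$ if some asserted, rup or cp step adds $C$ to $x$ and no later step deletes $C$ from $x$. Write $\Gamma\vdash_{UP}C$ if unit propagation on $\Gamma\cup\{\neg\ell:\ell\in C\}$ reaches a conflict. A sequence $\pi$ is a *valid modular DRUP proof* if, for every step $(\mathrm{rup},x,C)$ and every step $(\mathrm{cp}(x),\_,C)$, the set $\Gamma$ of clauses active in $x$ just before the step satisfies $\Gamma\vdash_{UP}C$, and the last step is $(\mathrm{rup},m,\bot)$ or $(\mathrm{cp}(s),m,\bot)$. It is a proof of unsatisfiability of $\Phi_s\wedge\Phi_m$ if moreover every clause asserted in $x$ is a clause of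 $\Phi_x$, for $x\in\{s,m\}$. **SpecSMS.** Each module $x$ has a search mode ($D^i$, $D^{i,j}$: decide; $P$: propagate; $F$: finished), a clause database (initially $\Phi_x$), a trail of assigned literals with decision levels and reasons, and possibly a conflict clause; the current decision level is common to both. Whenever a shared literal is put on one trail, it is also put on the other, where it has no reason clause (it is *external*). The initial modes, $\langle s,m\rangle=\langle P,D^0\rangle$, are called *normal*. The log starts with asserted steps for all input clauses; whenever a clause that module $x$ does not have is learnt in $x$, or copied to $x$ from the other module, a rup or cp step is appended, and a del step whenever a clause is deleted. All choices among the following transitions are nondeterministic. *If no module has a conflict* (and the modes are not $\langle F,F\rangle$): - A module not in mode $F$ propagates the unassigned literal of a unit clause, with this clause as reason. - A module in a mode $D$ opens a new decision level and decides an unassigned variable of its formula. - A module deletes a clause that is neither an input clause nor the reason of a literal on its trail. - A module takes a clause of its database that its trail falsifies as its conflict clause. - In $\langle P,D^0\rangle$ at level $i$: if $m$ has a full satisfying assignment of its clauses, the modes become $\langle D^i,F\rangle$; if no clause is unit in either module, they may become $\langle D^i,P\rangle$ (speculation). - When $s$ has a full satisfying assignment of its clauses: $\langle D^i,P\rangle$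 becomes $\langle F,D^{i,j}\rangle$ (validation), $j$ being the current level, and $\langle D^i,F\rangle$ becomes $\langle F,F\rangle$. When $m$ has one, $\langle F,D^{i,j}\rangle$ becomes $\langle F,F\rangle$. *If module $x$ has conflict clause $C$*: - *Explain*: $C$ is resolved with the reason clause in $x$ of a literal $\ell$ with $\neg\ell\in C$. - *Reason*: for an external $\ell$ with $\neg\ell\in C$, the other module starts from its own reason clause of $\ell$ and resolves away all local literals. If this yields a shared clause, the clause is copied to $x$ and becomes the reason of $\ell$ there; otherwise (or if the other module decided $\ell$) we say that Reason *fails*. - *Backjump to level $b$*: if exactly one literal of $C$ was falsified above level $b$, then $x$ learns $C$, both modules backjump to $b$, and that literal is assigned in $x$ with reason $C$. It is allowed for $x=m$ in $\langle P,D^0\rangle$; for $x=s$ in mode $D^i$ if $b\ge i$; for $x=m$ in $\langle F,D^{i,j}\rangle$ if $b\ge j$, or if $b<i$, in which case the modes become normal. - $x=s$, $C$ shared: if $s$ is in mode $P$, $C$ is copied to $m$ and becomes the conflict of $m$ instead of $s$. If $s$ is in mode $D^i$ and all literals of $C$ were falsified at levels at most $i$, then the same happens, both modules backjump to $i$, and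 the modes become normal. - $x=m$, modes $\langle D^i,P\rangle$: if $C$ is shared, it is copied to $s$ and becomes the conflict of $s$ instead of $m$. If all literals of $C$ were falsified at levels at most $i$, both modules may backjump to $i$, keeping the conflict in $m$, and the modes become normal. - *Refinement*: the conflict is dropped, both modules backjump to level $i$, the modes become normal, and $m$ opens a new level and decides the variable of a literal $\ell$ assigned above level $i$. It is allowed when $s$ in mode $D^i$, or $m$ in $\langle F,D^{i,j}\rangle$, has a conflict clause containing $\neg\ell$ with $\ell$ external and Reason fails for $\ell$; and, for any shared $\ell$, when $m$ in $\langle D^i,P\rangle$ has a conflict clause containing the negation of one of its own decisions of a local variable. - *Fail*: if $x=m$ and $C=\bot$, then $(\mathrm{rup},m,\bot)$ is logged and the final state *unsat* is reached. **Theorem.** Suppose that $\Phi_s\wedge\Phi_m$ is unsatisfiable. Then SpecSMS produces a valid modular DRUP proof of unsatisfiability of $\Phi_s\wedge\Phi_m$: it has no infinite execution from its initial state, and every execution that cannot be continued has reached the state *unsat*, with a log that is a valid modular DRUP proof of unsatisfiability of $\Phi_s\wedge\Phi_m$. -/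

import Mathlib

namespace SpecSMS

/-! ### Propositional logic, unit propagation and modular DRUP proofs -/

/-- The two modules: `s` is the secondary module and `m` is the main module. -/
inductive Idx where
  | s
  | m
  deriving DecidableEq

def Idx.other : Idx → Idx
  | .s => .m
  | .m => .s

/-- A literal is a variable with a polarity. -/
abbrev Lit (V : Type*) := V × Bool

/-- A clause is a finite set of literals (read disjunctively); the empty set is `⊥`. -/
abbrev Clause (V : Type*) := Finset (Lit V)

/-- A CNF formula is a finite list of clauses (read conjunctively). -/
abbrev Cnf (V : Type*) := List (Clause V)

def neg {V : Type*} (l : Lit V) : Lit V := (l.1, !l.2)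

/-- The assignment `τ` satisfies every clause of `Φ`. -/
def Cnf.SatBy {V : Type*} (Φ : Cnf V) (τ : V → Bool) : Prop :=
  ∀ C ∈ Φ, ∃ l ∈ C, τ l.1 = l.2

def vars {V : Type*} [DecidableEq V] (Φ : Cnf V) : Finset V :=
  Φ.toFinset.biUnion (fun C => C.image Prod.fst)

/-- `UPLit Γ l`: unit propagation on the set of clauses `Γ` derives the literal `l`. -/
inductive UPLit {V : Type*} (Γ : Set (Clause V)) : Lit V → Prop where
  | unit (C : Clause V) (l : Lit V) (hC : C ∈ Γ) (hl : l ∈ C)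
      (h : ∀ k ∈ C, k ≠ l → UPLit Γ (neg k)) : UPLit Γ l

/-- Unit propagation on `Γ` falsifies a clause of `Γ`. -/
def UPConflict {V : Type*} (Γ : Set (Clause V)) : Prop :=
  ∃ C ∈ Γ, ∀ l ∈ C, UPLit Γ (neg l)

/-- `Γ ⊢_UP C`: unit propagation on `Γ`, together with the negations of the literals of `C` as
unit clauses, reaches a conflict. -/
def RUP {V : Type*} (Γ : Set (Clause V)) (C : Clause V) : Prop :=
  UPConflict (Γ ∪ {D | ∃ l ∈ C, D = {neg l}})

/-- The steps of a modular clausal proof. -/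
inductive ProofStep (V : Type*) where
  | asserted (x : Idx) (C : Clause V)
  | rup (x : Idx) (C : Clause V)
  | cp (src dst : Idx) (C : Clause V)
  | del (x : Idx) (C : Clause V)

/-- The step adds the clause `C` to the module `x`. -/
def ProofStep.Adds {V : Type*} (p : ProofStep V) (x : Idx) (C : Clause V) : Prop :=
  p = .asserted x C ∨ p = .rup x C ∨ ∃ src, p = .cp src x C

/-- The clauses that are active in module `x` after the steps `π`. -/
def actCls {V : Type*} (π : List (ProofStep V)) (x : Idx) : Set (Clause V) :=
  {C | ∃ j : ℕ, (∃ p : ProofStep V, π[j]? = some p ∧ p.Adds x C) ∧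
    ¬ ∃ k : ℕ, j < k ∧ π[k]? = some (ProofStep.del x C)}

/-- The clauses asserted in module `x` by `π`. -/
def allAsserted {V : Type*} (π : List (ProofStep V)) (x : Idx) : Set (Clause V) :=
  {C | ProofStep.asserted x C ∈ π}

/-- Validity of a modular DRUP proof. Every `rup` clause is checked in its module, and every copied
clause in its source module, against the clauses active *before* the step; the last step adds `⊥`
to the main module. -/
structure ValidModularDRUP {V : Type*} (π : List (ProofStep V)) : Prop where
  rup_ok : ∀ (k : ℕ) (x : Idx) (C : Clause V), π[k]? = some (.rup x C) →
    RUP (actCls (π.take k) x) C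
  cp_ok : ∀ (k : ℕ) (src dst : Idx) (C : Clause V), π[k]? = some (.cp src dst C) →
    RUP (actCls (π.take k) src) C
  last_ok : π.getLast? = some (.rup .m ∅) ∨ π.getLast? = some (.cp .s .m ∅)

/-- `π` is a valid modular DRUP proof of unsatisfiability of `Φ s ∧ Φ m`. -/
def IsModularDRUPProofOf {V : Type*} (π : List (ProofStep V)) (Φ : Idx → Cnf V) : Prop :=
  ValidModularDRUP π ∧ ∀ x, allAsserted π x ⊆ {C | C ∈ Φ x}

/-! ### Configurations of the solver -/

/-- Search modes: `decide i` is `D^i`, `validate i j` is `D^{i,j}`, `propagate` is `P`,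
`finished` is `F`. -/
inductive Mode where
  | decide (i : ℕ)
  | validate (i j : ℕ)
  | propagate
  | finished

/-- Why a literal is on a trail: it was decided by this module, it was propagated by a clause of
this module, or it was received from the other module and has no reason clause here. -/
inductive Reason (V : Type*) where
  | decision
  | clause (C : Clause V)
  | ext

/-- A trail entry. Decision levels of the two modules are kept in sync; they are recorded
in the entries, so that no null literals are needed. -/
structure Entry (V : Type*) where
  lit : Lit V
  level : ℕ
  reason : Reason V

/-- The state of one module: search mode, conflict clause (if any), clause database and trail
(latest entry first). -/
structure Solver (V : Type*) where
  mode : Mode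
  conflict : Option (Clause V)
  db : Finset (Clause V)
  trail : List (Entry V)

/-- The two modules, their common current decision level, and the proof logged so far. -/
structure Config (V : Type*) where
  sol : Idx → Solver V
  level : ℕ
  log : List (ProofStep V)

/-- A state of SpecSMS: a configuration, or the final state `unsat` with the logged proof. -/
inductive State (V : Type*) where
  | run (c : Config V)
  | unsat (log : List (ProofStep V))

section Trail

variable {V : Type*}

/-- The literal `l` is true on the trail. -/
def OnTrail (t : List (Entry V)) (l : Lit V) : Prop := ∃ e ∈ t, e.lit = l

def Unassigned (t : List (Entry V)) (l : Lit V) : Prop := ¬ OnTrail t l ∧ ¬ OnTrail t (neg l)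

/-- Every literal of the clause is false on the trail. -/
def Falsified (t : List (Entry V)) (C : Clause V) : Prop := ∀ l ∈ C, OnTrail t (neg l)

/-- The clause `C` is unit on the trail, with unassigned literal `l`. -/
def IsUnit (t : List (Entry V)) (C : Clause V) (l : Lit V) : Prop :=
  l ∈ C ∧ Unassigned t l ∧ ∀ k ∈ C, k ≠ l → OnTrail t (neg k)

/-- Every false literal of `C` was falsified at level at most `b`. -/
def LevelsLE (t : List (Entry V)) (C : Clause V) (b : ℕ) : Prop :=
  ∀ e ∈ t, neg e.lit ∈ C → e.level ≤ b

/-- All variables of the clause are interface variables. -/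
def SharedClause (I : Finset V) (C : Clause V) : Prop := ∀ l ∈ C, l.1 ∈ I

/-- After backjumping to level `b`, the conflict clause `C` is unit, with `neg e.lit` its only
unassigned literal. -/
def Asserting (t : List (Entry V)) (C : Clause V) (e : Entry V) (b : ℕ) : Prop :=
  e ∈ t ∧ neg e.lit ∈ C ∧ b < e.level ∧
    ∀ e' ∈ t, neg e'.lit ∈ C → e'.lit ≠ e.lit → e'.level ≤ b

/-- The trail assigns all variables in `vs` and makes some literal of every clause in `db` true. -/
def FullSat (vs : Finset V) (s : Solver V) : Prop :=
  (∀ v ∈ vs, ∃ e ∈ s.trail, e.lit.1 = v) ∧ ∀ C ∈ s.db, ∃ l ∈ C, OnTrail s.trail l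

/-- Resolvent of `C ∋ neg l` and the reason clause `R ∋ l`. -/
def resolve [DecidableEq V] (C : Clause V) (l : Lit V) (R : Clause V) : Clause V :=
  C.erase (neg l) ∪ R.erase l

/-- One resolution of a non-interface literal of `C` with its reason on the trail. -/
def LocalResolve [DecidableEq V] (I : Finset V) (t : List (Entry V)) (C C' : Clause V) : Prop :=
  ∃ e ∈ t, ∃ R, e.reason = .clause R ∧ neg e.lit ∈ C ∧ e.lit.1 ∉ I ∧ C' = resolve C e.lit R

/-- `InterfaceReason I t l c`: on the trail `t`, the final conflict analysis of the propagated
literal `l` (start from its reason clause and resolve away the non-interface literals)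
yields the clause `c`, and `c` is over the interface variables. -/
def InterfaceReason [DecidableEq V] (I : Finset V) (t : List (Entry V)) (l : Lit V)
    (c : Clause V) : Prop :=
  ∃ e ∈ t, e.lit = l ∧ ∃ R, e.reason = .clause R ∧
    Relation.ReflTransGen (LocalResolve I t) R c ∧ SharedClause I c

end Trail

namespace Config

variable {V : Type*}

/-- No module has a pending conflict, and the final state `⟨F, F⟩` is not reached. -/
def Quiet (c : Config V) : Prop :=
  (∀ x, (c.sol x).conflict = none) ∧ ∃ x, (c.sol x).mode ≠ .finished

/-- The state `⟨P, D^0⟩` of normal execution. -/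
def Normal (c : Config V) : Prop :=
  (c.sol .s).mode = .propagate ∧ (c.sol .m).mode = .decide 0

/-- Module `x` assigns `l` with reason `r` at the current level. If the variable of `l` is shared,
then `l` is also put on the trail of the other module, with an external reason. -/
def assign [DecidableEq V] (I : Finset V) (c : Config V) (x : Idx) (l : Lit V) (r : Reason V) :
    Config V :=
  { c with sol := fun y => { c.sol y with trail :=
      if y = x then ⟨l, c.level, r⟩ :: (c.sol y).trail
      else if l.1 ∈ I then ⟨l, c.level, .ext⟩ :: (c.sol y).trail
      else (c.sol y).trail } }

/-- Both modules backjump to level `b`. -/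
def backTo (c : Config V) (b : ℕ) : Config V :=
  { c with
    level := b
    sol := fun y => { c.sol y with trail := (c.sol y).trail.filter (fun e => e.level ≤ b) } }

def setModes (c : Config V) (ms mm : Mode) : Config V :=
  { c with sol := fun y => { c.sol y with mode := match y with | .s => ms | .m => mm } }

def setConflict (c : Config V) (x : Idx) (o : Option (Clause V)) : Config V :=
  { c with sol := fun y => { c.sol y with conflict := if y = x then o else (c.sol y).conflict } }

def incLevel (c : Config V) : Config V := { c with level := c.level + 1 }

/-- Add `C` to module `x` and log the step `p`, unless the module already has `C`. -/
def addClause [DecidableEq V] (c : Config V) (x : Idx) (C : Clause V) (p : ProofStep V) :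
    Config V :=
  if C ∈ (c.sol x).db then c
  else
    { c with
      sol := fun y => { c.sol y with db := if y = x then insert C (c.sol y).db else (c.sol y).db }
      log := c.log ++ [p] }

/-- Learn `C` in module `x`. -/
def learn [DecidableEq V] (c : Config V) (x : Idx) (C : Clause V) : Config V :=
  c.addClause x C (.rup x C)

/-- Copy `C` to module `dst` from the other module. -/
def copyTo [DecidableEq V] (c : Config V) (dst : Idx) (C : Clause V) : Config V :=
  c.addClause dst C (.cp dst.other dst C)

/-- Delete `C` from module `x`. -/
def delete [DecidableEq V] (c : Config V) (x : Idx) (C : Clause V) : Config V :=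
  { c with
    sol := fun y => { c.sol y with db := if y = x then (c.sol y).db.erase C else (c.sol y).db }
    log := c.log ++ [.del x C] }

/-- In module `x`, make `C` the reason of the literal `l`. -/
def setReason [DecidableEq V] (c : Config V) (x : Idx) (l : Lit V) (C : Clause V) : Config V :=
  let upd : Entry V → Entry V := fun e => if e.lit = l then { e with reason := .clause C } else e
  let newTrail : Idx → List (Entry V) := fun y =>
    if y = x then (c.sol y).trail.map upd else (c.sol y).trail
  { c with sol := fun y => { c.sol y with trail := newTrail y } }

/-- Resolve the conflict `C` of module `x`: learn `C`, backjump to level `b`, and assign the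
literal `l` that `C` then implies. -/
def backjump [DecidableEq V] (I : Finset V) (c : Config V) (x : Idx) (C : Clause V) (l : Lit V)
    (b : ℕ) : Config V :=
  ((((c.setConflict x none).learn x C).backTo b).assign I x l (.clause C))

/-- Refinement: drop the conflict, backjump to the level `i` at which speculation started, return
to `⟨P, D^0⟩`, and let the main module decide the literal `l`. -/
def refine [DecidableEq V] (I : Finset V) (c : Config V) (i : ℕ) (l : Lit V) : Config V :=
  (((((c.setConflict .s none).setConflict .m none).backTo i).setModes .propagate
    (.decide 0)).incLevel).assign I .m l .decision

end Config

/-- The initial state `⟨P, D^0⟩` on the input `Φ`, with the input clauses logged as asserted. -/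
def start {V : Type*} [DecidableEq V] (Φ : Idx → Cnf V) : State V :=
  .run
    { sol := fun x =>
        { mode := match x with | .s => .propagate | .m => .decide 0
          conflict := none
          db := (Φ x).toFinset
          trail := [] }
      level := 0
      log := (Φ .s).map (.asserted .s) ++ (Φ .m).map (.asserted .m) }

/-- The interface variables: those that occur in both formulas. -/
def interface {V : Type*} [DecidableEq V] (Φ : Idx → Cnf V) : Finset V :=
  vars (Φ .s) ∩ vars (Φ .m)

/-- The transitions of SpecSMS on the input `Φ`. All choices (of the rule, of decisions, of when to
speculate, of the clauses to delete, ...) are nondeterministic. -/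
inductive Trans {V : Type*} [DecidableEq V] (Φ : Idx → Cnf V) : State V → State V → Prop where
  /-- Unit propagation. -/
  | propagate (c : Config V) (x : Idx) (C : Clause V) (l : Lit V)
      (hq : c.Quiet) (hmode : (c.sol x).mode ≠ .finished)
      (hC : C ∈ (c.sol x).db) (hu : IsUnit (c.sol x).trail C l) :
      Trans Φ (.run c) (.run (c.assign (interface Φ) x l (.clause C)))
  /-- A decision of a module in mode `D`. -/
  | decide (c : Config V) (x : Idx) (l : Lit V)
      (hq : c.Quiet)
      (hmode : (∃ i, (c.sol x).mode = .decide i) ∨ ∃ i j, (c.sol x).mode = .validate i j)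
      (hv : l.1 ∈ vars (Φ x)) (hu : Unassigned (c.sol x).trail l) :
      Trans Φ (.run c) (.run (c.incLevel.assign (interface Φ) x l .decision))
  /-- A clause that is neither an input clause nor the reason of a trail literal is deleted. -/
  | delete (c : Config V) (x : Idx) (C : Clause V)
      (hq : c.Quiet) (hC : C ∈ (c.sol x).db) (hin : C ∉ Φ x)
      (hlock : ∀ e ∈ (c.sol x).trail, e.reason ≠ .clause C) :
      Trans Φ (.run c) (.run (c.delete x C))
  /-- A clause is found to be falsified. -/
  | conflict (c : Config V) (x : Idx) (C : Clause V)
      (hq : c.Quiet) (hC : C ∈ (c.sol x).db) (hf : Falsified (c.sol x).trail C) :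
      Trans Φ (.run c) (.run (c.setConflict x (some C)))
  /-- Conflict analysis: resolve the conflict clause with a reason clause. -/
  | explain (c : Config V) (x : Idx) (C R : Clause V) (e : Entry V)
      (hC : (c.sol x).conflict = some C) (he : e ∈ (c.sol x).trail)
      (hl : neg e.lit ∈ C) (hr : e.reason = .clause R) :
      Trans Φ (.run c) (.run (c.setConflict x (some (resolve C e.lit R))))
  /-- Conflict analysis: the missing reason of an external literal is obtained from the other
  module and copied. -/
  | getReason (c : Config V) (x : Idx) (C R : Clause V) (e : Entry V)
      (hC : (c.sol x).conflict = some C) (he : e ∈ (c.sol x).trail)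
      (hl : neg e.lit ∈ C) (hr : e.reason = .ext)
      (hR : InterfaceReason (interface Φ) (c.sol x.other).trail e.lit R) :
      Trans Φ (.run c) (.run ((c.copyTo x R).setReason x e.lit R))
  /-- Normal execution: an interface conflict clause of the secondary module is copied to the main
  module, which takes over the conflict. -/
  | handOver (c : Config V) (C : Clause V)
      (hmode : (c.sol .s).mode = .propagate)
      (hC : (c.sol .s).conflict = some C) (hI : SharedClause (interface Φ) C) :
      Trans Φ (.run c) (.run (((c.copyTo .m C).setConflict .s none).setConflict .m (some C)))
  /-- Normal execution: the main module learns an asserting clause and backjumps. -/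
  | backjump (c : Config V) (C : Clause V) (e : Entry V) (b : ℕ)
      (hmode : c.Normal)
      (hC : (c.sol .m).conflict = some C) (ha : Asserting (c.sol .m).trail C e b) :
      Trans Φ (.run c) (.run (c.backjump (interface Φ) .m C (neg e.lit) b))
  /-- The empty clause is derived in the main module. -/
  | fail (c : Config V) (hC : (c.sol .m).conflict = some ∅) :
      Trans Φ (.run c) (.unsat (c.log ++ [.rup .m ∅]))
  /-- `⟨P, D^0⟩ → ⟨D^N, F⟩`: the main module has found a full satisfying assignment. -/
  | mainSat (c : Config V)
      (hq : c.Quiet) (hmode : c.Normal) (hsat : FullSat (vars (Φ .m)) (c.sol .m)) :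
      Trans Φ (.run c) (.run (c.setModes (.decide c.level) .finished))
  /-- `⟨P, D^0⟩ → ⟨D^i, P⟩`: speculation starts. -/
  | speculate (c : Config V)
      (hq : c.Quiet) (hmode : c.Normal)
      (hunit : ∀ x, ∀ C ∈ (c.sol x).db, ∀ l, ¬ IsUnit (c.sol x).trail C l) :
      Trans Φ (.run c) (.run (c.setModes (.decide c.level) .propagate))
  /-- The deciding secondary module learns an asserting clause and backjumps, but not below its
  assumption level. -/
  | secBackjump (c : Config V) (C : Clause V) (e : Entry V) (i b : ℕ)
      (hmode : (c.sol .s).mode = .decide i)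
      (hC : (c.sol .s).conflict = some C) (ha : Asserting (c.sol .s).trail C e b) (hb : i ≤ b) :
      Trans Φ (.run c) (.run (c.backjump (interface Φ) .s C (neg e.lit) b))
  /-- The conflict of the deciding secondary module depends on assumption levels only: its
  interface conflict clause is copied to the main module, and normal execution resumes. -/
  | secBlocked (c : Config V) (C : Clause V) (i : ℕ)
      (hmode : (c.sol .s).mode = .decide i)
      (hC : (c.sol .s).conflict = some C) (hI : SharedClause (interface Φ) C)
      (hlev : LevelsLE (c.sol .s).trail C i) :
      Trans Φ (.run c) (.run (((((c.copyTo .m C).setConflict .s none).setConflict .m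
        (some C)).backTo i).setModes .propagate (.decide 0)))
  /-- Speculation: an interface conflict clause of the main module is copied to the secondary
  module, which takes over the conflict. -/
  | mainToSec (c : Config V) (C : Clause V) (i : ℕ)
      (hs : (c.sol .s).mode = .decide i) (hm : (c.sol .m).mode = .propagate)
      (hC : (c.sol .m).conflict = some C) (hI : SharedClause (interface Φ) C) :
      Trans Φ (.run c) (.run (((c.copyTo .s C).setConflict .m none).setConflict .s (some C)))
  /-- Speculation: the conflict of the main module is below the level at which speculation started;
  normal execution resumes with this conflict. -/
  | mainBlocked (c : Config V) (C : Clause V) (i : ℕ)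
      (hs : (c.sol .s).mode = .decide i) (hm : (c.sol .m).mode = .propagate)
      (hC : (c.sol .m).conflict = some C) (hlev : LevelsLE (c.sol .m).trail C i) :
      Trans Φ (.run c) (.run ((c.backTo i).setModes .propagate (.decide 0)))
  /-- Refinement of a conflict of the secondary module: it depends on an external literal for which
  the main module has no interface reason. -/
  | secRefine (c : Config V) (C : Clause V) (e : Entry V) (i : ℕ) (l : Lit V)
      (hmode : (c.sol .s).mode = .decide i)
      (hC : (c.sol .s).conflict = some C) (he : e ∈ (c.sol .s).trail)
      (hl : neg e.lit ∈ C) (hr : e.reason = .ext) (hlev : i < e.level)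
      (hR : ∀ R, ¬ InterfaceReason (interface Φ) (c.sol .m).trail e.lit R)
      (hvar : l.1 = e.lit.1) :
      Trans Φ (.run c) (.run (c.refine (interface Φ) i l))
  /-- Refinement of a conflict of the main module during speculation: it depends on a local decision
  of the main module. The main module decides an interface variable assigned by speculation. -/
  | mainRefine (c : Config V) (C : Clause V) (d e : Entry V) (i : ℕ) (l : Lit V)
      (hs : (c.sol .s).mode = .decide i) (hm : (c.sol .m).mode = .propagate)
      (hC : (c.sol .m).conflict = some C)
      (hd : d ∈ (c.sol .m).trail) (hdC : neg d.lit ∈ C) (hdr : d.reason = .decision)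
      (hdI : d.lit.1 ∉ interface Φ)
      (he : e ∈ (c.sol .s).trail) (heI : e.lit.1 ∈ interface Φ) (hlev : i < e.level)
      (hvar : l.1 = e.lit.1) :
      Trans Φ (.run c) (.run (c.refine (interface Φ) i l))
  /-- `⟨D^i, P⟩ → ⟨F, D^{i,M}⟩`: the secondary module has found a full satisfying assignment, and
  validation starts. -/
  | validate (c : Config V) (i : ℕ)
      (hq : c.Quiet) (hs : (c.sol .s).mode = .decide i) (hm : (c.sol .m).mode = .propagate)
      (hsat : FullSat (vars (Φ .s)) (c.sol .s)) :
      Trans Φ (.run c) (.run (c.setModes .finished (.validate i c.level)))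
  /-- `⟨D^N, F⟩ → ⟨F, F⟩`. -/
  | secSat (c : Config V) (i : ℕ)
      (hq : c.Quiet) (hs : (c.sol .s).mode = .decide i) (hm : (c.sol .m).mode = .finished)
      (hsat : FullSat (vars (Φ .s)) (c.sol .s)) :
      Trans Φ (.run c) (.run (c.setModes .finished .finished))
  /-- `⟨F, D^{i,j}⟩ → ⟨F, F⟩`. -/
  | validated (c : Config V) (i j : ℕ)
      (hq : c.Quiet) (hs : (c.sol .s).mode = .finished) (hm : (c.sol .m).mode = .validate i j)
      (hsat : FullSat (vars (Φ .m)) (c.sol .m)) :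
      Trans Φ (.run c) (.run (c.setModes .finished .finished))
  /-- Validation: the main module backjumps, but not below the level at which validation started. -/
  | valBackjump (c : Config V) (C : Clause V) (e : Entry V) (i j b : ℕ)
      (hs : (c.sol .s).mode = .finished) (hm : (c.sol .m).mode = .validate i j)
      (hC : (c.sol .m).conflict = some C) (ha : Asserting (c.sol .m).trail C e b) (hb : j ≤ b) :
      Trans Φ (.run c) (.run (c.backjump (interface Φ) .m C (neg e.lit) b))
  /-- Validation: the main module backjumps below the level at which speculation started, and
  normal execution resumes. -/
  | valExit (c : Config V) (C : Clause V) (e : Entry V) (i j b : ℕ)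
      (hs : (c.sol .s).mode = .finished) (hm : (c.sol .m).mode = .validate i j)
      (hC : (c.sol .m).conflict = some C) (ha : Asserting (c.sol .m).trail C e b) (hb : b < i) :
      Trans Φ (.run c) (.run ((c.backjump (interface Φ) .m C (neg e.lit) b).setModes
        .propagate (.decide 0)))
  /-- Refinement of a conflict found in validation: it depends on an external literal, assigned
  by speculation, for which the secondary module has no interface reason. -/
  | valRefine (c : Config V) (C : Clause V) (e : Entry V) (i j : ℕ) (l : Lit V)
      (hs : (c.sol .s).mode = .finished) (hm : (c.sol .m).mode = .validate i j)
      (hC : (c.sol .m).conflict = some C) (he : e ∈ (c.sol .m).trail)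
      (hl : neg e.lit ∈ C) (hr : e.reason = .ext) (hlev : i < e.level)
      (hR : ∀ R, ¬ InterfaceReason (interface Φ) (c.sol .s).trail e.lit R)
      (hvar : l.1 = e.lit.1) :
      Trans Φ (.run c) (.run (c.refine (interface Φ) i l))

end SpecSMS

/-! The proof combines an invariant `Inv` kept by every transition (`Inv.step`), a rank in a
lexicographic product of copies of ℕ that every transition lowers (`Inv.rank_lt`), and the absence
of deadlocks in configurations satisfying the invariant (`Inv.canStep`).

Validity of the log. The clauses active in the log are exactly those in the databases, and every
conflict clause is RUP for the database of its module, because RUP survives resolution with a clause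
of the database (`RUP.resolve`). So learnt and copied clauses pass their checks, and so does ⊥ once
it is the conflict of the main module.

Progress. The two trails agree on shared literals, including their order and levels, and `ModeInv`
records at which levels each module may decide: `s` never decides at or below the level `i` where
speculation started. Once Explain and Reason no longer apply, the literals of a conflict clause are
decisions, or external literals without interface reason. Decisions have distinct levels, so a
clause falsified by decisions alone is asserting. An external literal below all decisions of the
other module does have an interface reason, since its local antecedents there are all propagated.
The remaining conflicts are covered by refinement, by transfer of a shared clause, or by the return
to normal execution when only levels up to `i` matter. Without a conflict, only full satisfying
assignments could end the search, and two of them would combine into a model (`FullSat.satBy`).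

Termination. Trail entries are weighted so that one entry of a level outweighs all possible entries
of higher levels; learning after a backjump then raises the weight. Refinement learns nothing and
discards the trail above `i`, so the leading component of the rank weighs only the trail up to the
base level: speculation preserves it, and refinement extends it by a decision at level `i + 1`.
Between two changes of this component the modes pass through finitely many stages, and within a
stage the full trail weight, the transfer of conflicts, the number of missing reasons, the conflict
clause and the database size decrease in turn. -/

namespace SpecSMS

/-! ### Unit propagation, RUP clauses and the justification of logs -/

section Logic

variable {V : Type*}

@[simp] theorem neg_neg (l : Lit V) : neg (neg l) = l := by simp [neg]

@[simp] theorem neg_fst (l : Lit V) : (neg l).1 = l.1 := rfl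

theorem neg_ne (l : Lit V) : neg l ≠ l := fun h => by
  have := congrArg Prod.snd h
  simp [neg] at this

theorem neg_injective : Function.Injective (neg : Lit V → Lit V) := fun a b h => by
  rw [← neg_neg a, h, neg_neg]

theorem eq_or_eq_neg {k l : Lit V} (h : k.1 = l.1) : k = l ∨ k = neg l := by
  obtain ⟨a, b⟩ := k
  obtain ⟨a', b'⟩ := l
  cases b <;> cases b' <;> simp_all [neg]

/-- A unit clause missing from `Δ` is dispensable when `Δ` propagates its literal: that derivation
replaces each use of the clause. -/
theorem UPLit.cut {Γ Δ : Set (Clause V)}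
    (h : ∀ C ∈ Γ, C ∈ Δ ∨ ∃ l, C = {l} ∧ UPLit Δ l) {l : Lit V} (hl : UPLit Γ l) :
    UPLit Δ l := by
  induction hl with
  | unit C l hC hl _ ih =>
    rcases h C hC with h' | ⟨k, rfl, hk⟩
    · exact .unit C l h' hl ih
    · rw [Finset.mem_singleton] at hl
      exact hl ▸ hk

/-- The clause that propagated `l` has all its other literals false, so deriving `neg l` falsifies
it entirely. -/
theorem UPConflict.of_contradictory {Γ : Set (Clause V)} {l : Lit V} (h : UPLit Γ l)
    (h' : UPLit Γ (neg l)) : UPConflict Γ := by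
  cases h with
  | unit C _ hC hl hk =>
    refine ⟨C, hC, fun k hkC => ?_⟩
    by_cases e : k = l
    · exact e ▸ h'
    · exact hk k hkC e

theorem UPLit.of_neg_mem {Γ : Set (Clause V)} {C : Clause V} {l : Lit V} (hl : l ∈ C) :
    UPLit (Γ ∪ {D | ∃ l ∈ C, D = {neg l}}) (neg l) :=
  .unit {neg l} _ (Or.inr ⟨l, hl, rfl⟩) (by simp) (by simp)

theorem RUP.of_mem {Γ : Set (Clause V)} {C : Clause V} (h : C ∈ Γ) : RUP Γ C :=
  ⟨C, Or.inl h, fun _ hl => UPLit.of_neg_mem hl⟩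

/-- The negated literals of `C` enter its check as unit clauses, and `UPLit.cut` removes them once
the negation of `D` propagates them. -/
theorem RUP.cut {Γ Δ : Set (Clause V)} {C D : Clause V} (h : RUP Γ C) (hs : Γ ⊆ Δ)
    (hD : ∀ l ∈ C, UPLit (Δ ∪ {E | ∃ l ∈ D, E = {neg l}}) (neg l)) : RUP Δ D := by
  have key : ∀ E ∈ Γ ∪ {D | ∃ l ∈ C, D = {neg l}},
      E ∈ Δ ∪ {E | ∃ l ∈ D, E = {neg l}} ∨
        ∃ l, E = {l} ∧ UPLit (Δ ∪ {E | ∃ l ∈ D, E = {neg l}}) l := by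
    rintro E (hE | ⟨l, hl, rfl⟩)
    · exact Or.inl (Or.inl (hs hE))
    · exact Or.inr ⟨_, rfl, hD l hl⟩
  obtain ⟨E, hE, hf⟩ := h
  have hf' := fun l hl => (hf l hl).cut key
  -- The falsified clause may itself be one of the removed units; then a literal and its negation
  -- have both been derived.
  rcases key E hE with hE | ⟨l, rfl, hl⟩
  · exact ⟨E, hE, hf'⟩
  · exact .of_contradictory hl (hf' l (by simp))

theorem RUP.mono {Γ Δ : Set (Clause V)} {C : Clause V} (h : RUP Γ C) (hs : Γ ⊆ Δ) : RUP Δ C :=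
  h.cut hs fun _ hl => UPLit.of_neg_mem hl

/-- Negating the resolvent falsifies every literal of `R` except possibly `l`. If `l ∈ R`,
propagation gives `l` and thus falsifies `neg l`, the only literal of `C` that the resolvent may
lack. If `l ∉ R`, then `R` itself is falsified. -/
theorem RUP.resolve [DecidableEq V] {Γ : Set (Clause V)} {C R : Clause V} (h : RUP Γ C)
    (hR : R ∈ Γ) (l : Lit V) : RUP Γ (resolve C l R) := by
  have hR' : ∀ k ∈ R, k ≠ l →
      UPLit (Γ ∪ {D | ∃ k ∈ SpecSMS.resolve C l R, D = {neg k}}) (neg k) := fun k hk hkl =>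
    UPLit.of_neg_mem (by simp [SpecSMS.resolve, hk, hkl])
  by_cases hl : l ∈ R
  · refine h.cut subset_rfl fun k hk => ?_
    by_cases e : k = neg l
    · subst e
      rw [neg_neg]
      exact .unit R l (Or.inl hR) hl hR'
    · exact UPLit.of_neg_mem (by simp [SpecSMS.resolve, hk, e])
  · exact ⟨R, Or.inl hR, fun k hk => hR' k hk fun e => hl (e ▸ hk)⟩

theorem mem_vars [DecidableEq V] {Φ : Cnf V} {v : V} :
    v ∈ vars Φ ↔ ∃ C ∈ Φ, ∃ l ∈ C, l.1 = v := by
  simp [vars]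

/-! ### Proof logs -/

/-- A deletion cancels all earlier additions of the clause, however many. Active clauses therefore
evolve like a set under insertion and erasure, as the databases do. -/
theorem mem_actCls_append {π : List (ProofStep V)} {p : ProofStep V} {x : Idx} {C : Clause V} :
    C ∈ actCls (π ++ [p]) x ↔ p.Adds x C ∨ (C ∈ actCls π x ∧ p ≠ .del x C) := by
  have last : (π ++ [p])[π.length]? = some p := by simp
  constructor
  · rintro ⟨j, ⟨q, hq, hadd⟩, hno⟩
    rcases lt_trichotomy j π.length with h | rfl | h
    · refine Or.inr ⟨⟨j, ⟨q, ?_, hadd⟩, ?_⟩, ?_⟩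
      · rwa [List.getElem?_append_left h] at hq
      · rintro ⟨k, hk, hk'⟩
        refine hno ⟨k, hk, ?_⟩
        rw [List.getElem?_append_left (List.getElem?_eq_some_iff.1 hk').1, hk']
      · rintro rfl
        exact hno ⟨_, h, last⟩
    · rw [last] at hq
      cases hq
      exact Or.inl hadd
    · rw [List.getElem?_eq_none (by simp; omega)] at hq
      cases hq
  · rintro (h | ⟨⟨j, ⟨q, hq, hadd⟩, hno⟩, hp⟩)
    · refine ⟨_, ⟨p, last, h⟩, ?_⟩
      rintro ⟨k, hk, hk'⟩
      rw [List.getElem?_eq_none (by simp; omega)] at hk'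
      cases hk'
    · have hj := (List.getElem?_eq_some_iff.1 hq).1
      refine ⟨j, ⟨q, by rwa [List.getElem?_append_left hj], hadd⟩, ?_⟩
      rintro ⟨k, hk, hk'⟩
      rcases lt_trichotomy k π.length with h | rfl | h
      · rw [List.getElem?_append_left h] at hk'
        exact hno ⟨k, hk, hk'⟩
      · rw [last] at hk'
        cases hk'
        exact hp rfl
      · rw [List.getElem?_eq_none (by simp; omega)] at hk'
        cases hk'

/-- All steps of the log are justified. -/
structure LogOK (Φ : Idx → Cnf V) (π : List (ProofStep V)) : Prop where
  rup_ok : ∀ (k : ℕ) (x : Idx) (C : Clause V), π[k]? = some (.rup x C) →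
    RUP (actCls (π.take k) x) C
  cp_ok : ∀ (k : ℕ) (src dst : Idx) (C : Clause V), π[k]? = some (.cp src dst C) →
    RUP (actCls (π.take k) src) C
  asserted : ∀ x C, ProofStep.asserted x C ∈ π → C ∈ Φ x

/-- The step is justified after the steps `π`. -/
def StepOK (π : List (ProofStep V)) : ProofStep V → Prop
  | .rup x C => RUP (actCls π x) C
  | .cp src _ C => RUP (actCls π src) C
  | .asserted _ _ => False
  | .del _ _ => True

/-- The check of a step depends only on the prefix before it, and appending changes none of the old
prefixes. -/
theorem LogOK.append {Φ : Idx → Cnf V} {π : List (ProofStep V)} {p : ProofStep V}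
    (h : LogOK Φ π) (hp : StepOK π p) : LogOK Φ (π ++ [p]) := by
  have key : ∀ (k : ℕ) (q : ProofStep V), (π ++ [p])[k]? = some q →
      (π[k]? = some q ∧ (π ++ [p]).take k = π.take k) ∨ (q = p ∧ (π ++ [p]).take k = π) := by
    intro k q hq
    rcases lt_trichotomy k π.length with h | rfl | h
    · rw [List.getElem?_append_left h] at hq
      exact Or.inl ⟨hq, List.take_append_of_le_length h.le⟩
    · simp at hq
      exact Or.inr ⟨hq.symm, by simp⟩
    · rw [List.getElem?_eq_none (by simp; omega)] at hq
      cases hq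
  refine ⟨fun k x C hk => ?_, fun k a b C hk => ?_, fun x C hx => ?_⟩
  · rcases key k _ hk with ⟨h1, h2⟩ | ⟨rfl, h2⟩
    · rw [h2]; exact h.rup_ok k x C h1
    · rw [h2]; exact hp
  · rcases key k _ hk with ⟨h1, h2⟩ | ⟨rfl, h2⟩
    · rw [h2]; exact h.cp_ok k a b C h1
    · rw [h2]; exact hp
  · rw [List.mem_append, List.mem_singleton] at hx
    rcases hx with hx | rfl
    · exact h.asserted x C hx
    · exact hp.elim

theorem actCls_of_asserted {π : List (ProofStep V)} {x : Idx}
    (h : ∀ p ∈ π, ∃ y C, p = .asserted y C) : actCls π x = {C | ProofStep.asserted x C ∈ π} := by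
  ext C
  constructor
  · rintro ⟨j, ⟨p, hp, ha⟩, -⟩
    have hp' := List.mem_of_getElem? hp
    obtain ⟨y, D, rfl⟩ := h p hp'
    rcases ha with ha | ha | ⟨_, ha⟩
    · rwa [ha] at hp'
    · cases ha
    · cases ha
  · intro hC
    obtain ⟨j, hj⟩ := List.getElem?_of_mem hC
    refine ⟨j, ⟨_, hj, Or.inl rfl⟩, ?_⟩
    rintro ⟨k, -, hk⟩
    obtain ⟨y, D, e⟩ := h _ (List.mem_of_getElem? hk)
    cases e

end Logic

/-! ### Well-formed trails and resolution along them -/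

section Trails

variable {V : Type*}

/-- Well-formed trails: assigned variables are distinct, levels are monotone, a reason clause
implies its literal from the earlier ones, and a decision opens a positive level. -/
def WF : List (Entry V) → Prop
  | [] => True
  | e :: t => Unassigned t e.lit ∧ (∀ a ∈ t, a.level ≤ e.level) ∧
      (∀ R, e.reason = .clause R → e.lit ∈ R ∧ ∀ k ∈ R, k ≠ e.lit → OnTrail t (neg k)) ∧
      (e.reason = .decision → 0 < e.level ∧ ∀ a ∈ t, a.level < e.level) ∧ WF t

theorem OnTrail.mono {t t' : List (Entry V)} (h : t ⊆ t') {l : Lit V} (hl : OnTrail t l) :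
    OnTrail t' l :=
  let ⟨e, he, h'⟩ := hl
  ⟨e, h he, h'⟩

theorem unassigned_iff {t : List (Entry V)} {l : Lit V} :
    Unassigned t l ↔ ∀ e ∈ t, e.lit.1 ≠ l.1 := by
  constructor
  · rintro ⟨h1, h2⟩ e he h
    rcases eq_or_eq_neg h with h | h
    · exact h1 ⟨e, he, h⟩
    · exact h2 ⟨e, he, h⟩
  · intro h
    exact ⟨fun ⟨e, he, h'⟩ => h e he (by rw [h']), fun ⟨e, he, h'⟩ => h e he (by rw [h', neg_fst])⟩

theorem WF.tail {e : Entry V} {t : List (Entry V)} (h : WF (e :: t)) : WF t := h.2.2.2.2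

theorem WF.of_append {t₁ t₂ : List (Entry V)} (h : WF (t₁ ++ t₂)) : WF t₂ := by
  induction t₁ with
  | nil => exact h
  | cons e t ih => exact ih h.tail

theorem WF.pairwise {t : List (Entry V)} (h : WF t) :
    t.Pairwise (fun a b => a.lit.1 ≠ b.lit.1 ∧ b.level ≤ a.level) := by
  induction t with
  | nil => exact .nil
  | cons e t ih =>
    exact .cons (fun a ha => ⟨(unassigned_iff.1 h.1 a ha).symm, h.2.1 a ha⟩) (ih h.tail)

theorem WF.nodup_vars {t : List (Entry V)} (h : WF t) : (t.map (fun e => e.lit.1)).Nodup := by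
  rw [List.Nodup, List.pairwise_map]
  exact h.pairwise.imp fun h => h.1

theorem WF.eq_of_var_eq {t : List (Entry V)} (h : WF t) {a b : Entry V} (ha : a ∈ t) (hb : b ∈ t)
    (hab : a.lit.1 = b.lit.1) : a = b :=
  List.inj_on_of_nodup_map h.nodup_vars ha hb hab

theorem WF.not_onTrail_neg {t : List (Entry V)} (h : WF t) {l : Lit V} (hl : OnTrail t l) :
    ¬ OnTrail t (neg l) := by
  rintro ⟨b, hb, hb'⟩
  obtain ⟨a, ha, ha'⟩ := hl
  have := h.eq_of_var_eq ha hb (by rw [ha', hb', neg_fst])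
  subst this
  exact neg_ne l (by rw [← hb', ha'])

theorem WF.reason {t : List (Entry V)} (h : WF t) {e : Entry V} (he : e ∈ t) {R : Clause V}
    (hR : e.reason = .clause R) :
    e.lit ∈ R ∧ ∀ k ∈ R, k ≠ e.lit → OnTrail t (neg k) := by
  obtain ⟨t₁, t₂, rfl⟩ := List.append_of_mem he
  obtain ⟨h1, h2⟩ := h.of_append.2.2.1 R hR
  exact ⟨h1, fun k hk hk' => (h2 k hk hk').mono (by simp)⟩

theorem WF.decision_pos {t : List (Entry V)} (h : WF t) {e : Entry V} (he : e ∈ t)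
    (hd : e.reason = .decision) : 0 < e.level := by
  obtain ⟨t₁, t₂, rfl⟩ := List.append_of_mem he
  exact (h.of_append.2.2.2.1 hd).1

/-- A decision lies strictly above the levels of all older entries, so the later of two decisions
has the larger level. -/
theorem WF.decision_unique {t : List (Entry V)} (h : WF t) {a b : Entry V} (ha : a ∈ t)
    (hb : b ∈ t) (hda : a.reason = .decision) (hdb : b.reason = .decision)
    (hl : a.level = b.level) : a = b := by
  induction t with
  | nil => cases ha
  | cons e t ih =>
    rcases List.mem_cons.1 ha with rfl | ha' <;> rcases List.mem_cons.1 hb with rfl | hb'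
    · rfl
    · exact absurd ((h.2.2.2.1 hda).2 b hb') (by omega)
    · exact absurd ((h.2.2.2.1 hdb).2 a ha') (by omega)
    · exact ih h.tail ha' hb'

/-- Levels grow with time, so the filter only drops the newest entries, and the conditions on an
entry mention older ones alone. -/
theorem WF.filter_level {t : List (Entry V)} (h : WF t) (b : ℕ) :
    WF (t.filter (fun e => e.level ≤ b)) := by
  induction t with
  | nil => exact trivial
  | cons e t ih =>
    by_cases he : e.level ≤ b
    · have : (e :: t).filter (fun e => e.level ≤ b) = e :: t := by
        refine List.filter_eq_self.2 fun a ha => ?_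
        rcases List.mem_cons.1 ha with rfl | ha
        · simpa using he
        · simpa using (h.2.1 a ha).trans he
      rwa [this]
    · rw [List.filter_cons_of_neg (by simpa using he)]
      exact ih h.tail

/-- The shared part of a trail, without the reasons. -/
def shPart [DecidableEq V] (I : Finset V) (t : List (Entry V)) : List (Lit V × ℕ) :=
  (t.filter (fun e => e.lit.1 ∈ I)).map (fun e => (e.lit, e.level))

theorem mem_shPart [DecidableEq V] {I : Finset V} {t : List (Entry V)} {l : Lit V} {n : ℕ} :
    (l, n) ∈ shPart I t ↔ l.1 ∈ I ∧ ∃ e ∈ t, e.lit = l ∧ e.level = n := by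
  simp only [shPart, List.mem_map, List.mem_filter, decide_eq_true_eq, Prod.mk.injEq]
  constructor
  · rintro ⟨e, ⟨he, hI⟩, rfl, rfl⟩
    exact ⟨hI, e, he, rfl, rfl⟩
  · rintro ⟨hI, e, he, rfl, rfl⟩
    exact ⟨e, ⟨he, hI⟩, rfl, rfl⟩

theorem shPart_cons [DecidableEq V] (I : Finset V) (e : Entry V) (t : List (Entry V)) :
    shPart I (e :: t) = if e.lit.1 ∈ I then (e.lit, e.level) :: shPart I t else shPart I t := by
  by_cases h : e.lit.1 ∈ I <;> simp [shPart, h]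

theorem shPart_append [DecidableEq V] (I : Finset V) (t t' : List (Entry V)) :
    shPart I (t ++ t') = shPart I t ++ shPart I t' := by
  simp [shPart]

theorem shPart_filter_level [DecidableEq V] (I : Finset V) (t : List (Entry V)) (b : ℕ) :
    shPart I (t.filter (fun e => e.level ≤ b)) = (shPart I t).filter (fun p => p.2 ≤ b) := by
  induction t with
  | nil => rfl
  | cons e t ih =>
    by_cases hb : e.level ≤ b <;> by_cases hI : e.lit.1 ∈ I <;> simp_all [shPart_cons]

theorem WF.nodup_shPart [DecidableEq V] {I : Finset V} {t : List (Entry V)} (h : WF t) :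
    ((shPart I t).map Prod.fst).Nodup := by
  induction t with
  | nil => simp [shPart]
  | cons e t ih =>
    rw [shPart_cons]
    split_ifs with hI
    · rw [List.map_cons, List.nodup_cons]
      refine ⟨?_, ih h.tail⟩
      rw [List.mem_map]
      rintro ⟨⟨l, n⟩, hp, rfl⟩
      obtain ⟨-, a, ha, ha', -⟩ := mem_shPart.1 hp
      exact h.1.1 ⟨a, ha, ha'⟩
    · exact ih h.tail

/-- Literals before a shared literal on one trail are before it on a synchronized trail. -/
theorem before_of_shPart_eq [DecidableEq V] {I : Finset V} {a b : Entry V}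
    {t₁ t₂ u₁ u₂ : List (Entry V)} (hw : WF (t₁ ++ a :: t₂))
    (hs : shPart I (t₁ ++ a :: t₂) = shPart I (u₁ ++ b :: u₂)) (hab : a.lit = b.lit)
    (hI : a.lit.1 ∈ I) {l : Lit V} (hl : l.1 ∈ I) (h : OnTrail t₂ l) : OnTrail u₂ l := by
  have hn := hw.nodup_shPart (I := I)
  have hs' := congrArg (List.map Prod.fst) hs
  rw [shPart_append, shPart_cons, if_pos hI, List.map_append, List.map_cons] at hn hs'
  rw [shPart_append, shPart_cons, if_pos (hab ▸ hI), List.map_append, List.map_cons] at hs'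
  -- Without repetitions the position of `x` is determined by the list, so both splittings at `x`
  -- are the same.
  have key : ∀ {α : Type _} {x : α} {p p' q q' : List α}, (p ++ x :: q).Nodup →
      p ++ x :: q = p' ++ x :: q' → q = q' := by
    intro α x p p' q q' hn he
    have hx : x ∉ p := fun h => by
      rw [List.nodup_append] at hn
      exact hn.2.2 x h x (by simp) rfl
    have hx' : x ∉ p' := fun h => by
      rw [he, List.nodup_append] at hn
      exact hn.2.2 x h x (by simp) rfl
    induction p generalizing p' with
    | nil =>
      cases p' with
      | nil => simpa using he
      | cons y p' =>
        simp only [List.nil_append, List.cons_append, List.cons.injEq] at he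
        exact absurd (List.mem_cons.2 (Or.inl he.1)) hx'
    | cons z p ih =>
      cases p' with
      | nil =>
        simp only [List.nil_append, List.cons_append, List.cons.injEq] at he
        exact absurd (List.mem_cons.2 (Or.inl he.1.symm)) hx
      | cons y p' =>
        simp only [List.cons_append, List.cons.injEq] at he
        exact ih (p' := p') (List.Nodup.of_cons hn) he.2 (fun h => hx (by simp [h]))
          (fun h => hx' (by simp [h]))
  rw [← hab] at hs'
  have := key hn hs'
  obtain ⟨e, he, rfl⟩ := h
  have hm : e.lit ∈ (shPart I t₂).map Prod.fst :=
    List.mem_map.2 ⟨(e.lit, e.level), mem_shPart.2 ⟨hl, e, he, rfl, rfl⟩, rfl⟩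
  rw [this, List.mem_map] at hm
  obtain ⟨⟨k, n⟩, hp, rfl⟩ := hm
  obtain ⟨-, e', he', h', -⟩ := mem_shPart.1 hp
  exact ⟨e', he', h'⟩

/-- A weight of the clause `C` that decreases when a literal is replaced by earlier ones. -/
def clauseWeight [DecidableEq V] (C : Clause V) : List (Entry V) → ℕ
  | [] => 0
  | e :: t => (if neg e.lit ∈ C then 2 ^ t.length else 0) + clauseWeight C t

theorem clauseWeight_lt [DecidableEq V] (C : Clause V) (t : List (Entry V)) :
    clauseWeight C t < 2 ^ t.length := by
  induction t with
  | nil => simp [clauseWeight]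
  | cons e t ih =>
    rw [clauseWeight, List.length_cons, pow_succ]
    split_ifs <;> omega

/-- The weight is a binary number with one digit per trail position. Resolution clears the digit of
`e`, leaves the digits of newer entries alone, and can set only those of older ones. -/
theorem clauseWeight_resolve [DecidableEq V] {t : List (Entry V)} (hw : WF t) {C R : Clause V}
    {e : Entry V} (he : e ∈ t) (hC : neg e.lit ∈ C) (hR : e.reason = .clause R) :
    clauseWeight (resolve C e.lit R) t < clauseWeight C t := by
  induction t with
  | nil => cases he
  | cons a t ih =>
    rw [clauseWeight, clauseWeight]
    rcases List.mem_cons.1 he with rfl | he'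
    · have hnot : neg e.lit ∉ resolve C e.lit R := by
        simp only [resolve, Finset.mem_union, Finset.mem_erase, not_or, not_and]
        refine ⟨fun h => absurd rfl h, fun _ h => ?_⟩
        have := (hw.2.2.1 R hR).2 _ h (neg_ne _)
        rw [neg_neg] at this
        exact hw.1.1 this
      rw [if_neg hnot, if_pos hC]
      have := clauseWeight_lt (resolve C e.lit R) t
      omega
    · have ih' := ih hw.tail he'
      -- The entry `a` is newer than `e`, so its literal cannot come from the reason of `e`.
      have hiff : neg a.lit ∈ resolve C e.lit R ↔ neg a.lit ∈ C := by
        have hne : a.lit.1 ≠ e.lit.1 := (unassigned_iff.1 hw.1 e he').symm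
        simp only [resolve, Finset.mem_union, Finset.mem_erase]
        constructor
        · rintro (h | ⟨h1, h2⟩)
          · exact h.2
          · have := (hw.tail.reason he' hR).2 _ h2 h1
            rw [neg_neg] at this
            exact absurd this hw.1.1
        · exact fun h => Or.inl ⟨fun h' => hne (by rw [neg_injective h']), h⟩
      simp only [hiff]
      omega

theorem Falsified.resolve [DecidableEq V] {t : List (Entry V)} (hw : WF t) {C R : Clause V}
    {e : Entry V} (hC : Falsified t C) (he : e ∈ t) (hR : e.reason = .clause R) :
    Falsified t (resolve C e.lit R) := by
  intro k hk
  simp only [SpecSMS.resolve, Finset.mem_union, Finset.mem_erase] at hk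
  rcases hk with h | ⟨h1, h2⟩
  · exact hC k h.2
  · exact (hw.reason he hR).2 k h2 h1

/-- The interface reason of a literal contains it, and its other literals are false earlier. -/
theorem InterfaceReason.spec [DecidableEq V] {I : Finset V} {t : List (Entry V)} (hw : WF t)
    {l : Lit V} {c : Clause V} (h : InterfaceReason I t l c) :
    SharedClause I c ∧ l ∈ c ∧ ∃ t₁ e t₂, t = t₁ ++ e :: t₂ ∧ e.lit = l ∧
      ∀ k ∈ c, k ≠ l → OnTrail t₂ (neg k) := by
  obtain ⟨e, he, rfl, R, hR, hstar, hsh⟩ := h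
  obtain ⟨t₁, t₂, rfl⟩ := List.append_of_mem he
  have hw2 := hw.of_append
  have main : e.lit ∈ c ∧ ∀ k ∈ c, k ≠ e.lit → OnTrail t₂ (neg k) := by
    -- The intermediate clauses of the resolution chain need not be shared.
    clear hsh
    induction hstar with
    | refl => exact hw2.2.2.1 R hR
    | tail _ h ih =>
      obtain ⟨a, ha, R', hR', haC, -, rfl⟩ := h
      -- The literal resolved away is false on the trail, whereas `e.lit` is true.
      have hne : neg a.lit ≠ e.lit := fun h =>
        hw.not_onTrail_neg (l := a.lit) ⟨a, ha, rfl⟩ (h ▸ ⟨e, he, rfl⟩)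
      have ha2 : a ∈ t₂ := by
        have := ih.2 _ haC hne
        rw [neg_neg] at this
        obtain ⟨a', ha', h'⟩ := this
        rwa [hw.eq_of_var_eq ha (b := a') (by simp [ha']) (by rw [h'])]
      refine ⟨by simp [resolve, ih.1, hne.symm], fun k hk hkl => ?_⟩
      simp only [resolve, Finset.mem_union, Finset.mem_erase] at hk
      rcases hk with h | ⟨h1, h2⟩
      · exact ih.2 k h.2 hkl
      · exact (hw2.tail.reason ha2 hR').2 k h2 h1
  exact ⟨hsh, main.1, t₁, e, t₂, rfl, rfl, main.2⟩

/-- This justifies copied reasons in their source module: the chain starts from a clause of `Γ` and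
resolves only with clauses of `Γ`. -/
theorem InterfaceReason.rup [DecidableEq V] {I : Finset V} {t : List (Entry V)} {l : Lit V}
    {c : Clause V} {Γ : Set (Clause V)} (h : InterfaceReason I t l c)
    (hΓ : ∀ e ∈ t, ∀ R, e.reason = .clause R → R ∈ Γ) : RUP Γ c := by
  obtain ⟨e, he, rfl, R, hR, hstar, -⟩ := h
  induction hstar with
  | refl => exact .of_mem (hΓ e he R hR)
  | tail _ h ih =>
    obtain ⟨a, ha, R', hR', -, -, rfl⟩ := h
    exact ih.resolve (hΓ a ha R' hR') _

/-- A propagated shared literal has an interface reason if all local literals up to its level are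
propagated. -/
theorem InterfaceReason.exists [DecidableEq V] {I : Finset V} {t : List (Entry V)} (hw : WF t)
    {e : Entry V} (he : e ∈ t) (hI : e.lit.1 ∈ I) {R : Clause V} (hR : e.reason = .clause R)
    (hloc : ∀ a ∈ t, a.lit.1 ∉ I → a.level ≤ e.level → ∃ R, a.reason = .clause R) :
    ∃ c, InterfaceReason I t e.lit c := by
  obtain ⟨t₁, t₂, rfl⟩ := List.append_of_mem he
  have hw2 := hw.of_append
  -- Strong induction on the weight, for all clauses whose literals other than `e.lit` are false
  -- before `e`; each local resolution stays in this class and lowers the weight.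
  suffices h : ∀ (n : ℕ) (C : Clause V), clauseWeight C (t₁ ++ e :: t₂) = n →
      (∀ k ∈ C, k ≠ e.lit → OnTrail t₂ (neg k)) →
      ∃ c, Relation.ReflTransGen (LocalResolve I (t₁ ++ e :: t₂)) C c ∧ SharedClause I c by
    obtain ⟨c, hc⟩ := h _ R rfl (hw2.2.2.1 R hR).2
    exact ⟨c, e, he, rfl, R, hR, hc⟩
  intro n
  induction n using Nat.strong_induction_on with
  | _ n ih =>
    intro C hn hC
    by_cases hsh : SharedClause I C
    · exact ⟨C, .refl, hsh⟩
    · simp only [SharedClause, not_forall] at hsh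
      obtain ⟨k, hk, hkI⟩ := hsh
      obtain ⟨a, ha, hak⟩ := hC k hk fun h => hkI (h ▸ hI)
      have hak' : neg a.lit = k := by rw [hak, neg_neg]
      have haI : a.lit.1 ∉ I := by rwa [hak]
      have ha' : a ∈ t₁ ++ e :: t₂ := by simp [ha]
      -- `a` is older than `e`, so its level is at most `e.level` and `hloc` applies.
      obtain ⟨R', hR'⟩ := hloc a ha' haI (hw2.2.1 a ha)
      obtain ⟨c, hc, hcI⟩ := ih _ (hn ▸ clauseWeight_resolve hw ha' (hak' ▸ hk) hR') _ rfl
        (fun j hj hjl => by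
          simp only [resolve, Finset.mem_union, Finset.mem_erase] at hj
          rcases hj with h | ⟨h1, h2⟩
          · exact hC j h.2 hjl
          · exact (hw2.tail.reason ha hR').2 j h2 h1)
      exact ⟨c, .head ⟨a, ha', R', hR', hak' ▸ hk, haI, rfl⟩ hc, hcI⟩

/-! ### Weights of trails -/

/-- The weight of the trail entries up to level `b`: entries of lower levels weigh more. -/
def trailWeight (M b : ℕ) (t : List (Entry V)) : ℕ :=
  ((t.filter (fun e => e.level ≤ b)).map (fun e => (M + 1) ^ (M - e.level))).sum

theorem trailWeight_cons (M b : ℕ) (e : Entry V) (t : List (Entry V)) :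
    trailWeight M b (e :: t) =
      (if e.level ≤ b then (M + 1) ^ (M - e.level) else 0) + trailWeight M b t := by
  by_cases h : e.level ≤ b <;> simp [trailWeight, h]

theorem trailWeight_filter (M : ℕ) {b b' : ℕ} (t : List (Entry V)) (h : b ≤ b') :
    trailWeight M b (t.filter (fun e => e.level ≤ b')) = trailWeight M b t := by
  unfold trailWeight
  rw [List.filter_filter]
  congr 2
  refine List.filter_congr fun e _ => ?_
  simp only [← Bool.decide_and, decide_eq_decide]
  omega

theorem trailWeight_le (M b : ℕ) (t : List (Entry V)) :
    trailWeight M b t ≤ t.length * (M + 1) ^ M := by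
  induction t with
  | nil => simp [trailWeight]
  | cons e t ih =>
    rw [trailWeight_cons, List.length_cons]
    have : (M + 1) ^ (M - e.level) ≤ (M + 1) ^ M := Nat.pow_le_pow_right (by omega) (by omega)
    rw [add_mul, one_mul]
    split_ifs <;> omega

/-- An entry counted on the left but not in `trailWeight M b t` has level at least `b + 1`, which
bounds its weight. -/
theorem trailWeight_le_add (M b b' : ℕ) (t : List (Entry V)) :
    trailWeight M b' t ≤ trailWeight M b t + t.length * (M + 1) ^ (M - (b + 1)) := by
  induction t with
  | nil => simp [trailWeight]
  | cons e t ih =>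
    rw [trailWeight_cons, trailWeight_cons, List.length_cons]
    have : ¬ e.level ≤ b → (M + 1) ^ (M - e.level) ≤ (M + 1) ^ (M - (b + 1)) := fun h =>
      Nat.pow_le_pow_right (by omega) (by omega)
    rw [add_mul, one_mul]
    split_ifs with h1 h2 h2
    · omega
    · have := this h2
      omega
    · omega
    · omega

theorem trailWeight_mono (M : ℕ) {b b' : ℕ} (h : b ≤ b') (t : List (Entry V)) :
    trailWeight M b t ≤ trailWeight M b' t := by
  induction t with
  | nil => simp [trailWeight]
  | cons e t ih =>
    rw [trailWeight_cons, trailWeight_cons]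
    split_ifs <;> omega

end Trails

theorem Idx.other_ne (x : Idx) : x.other ≠ x := by cases x <;> decide

@[simp] theorem Idx.other_other (x : Idx) : x.other.other = x := by cases x <;> rfl

theorem Idx.eq_other_of_ne {x y : Idx} (h : y ≠ x) : y = x.other := by
  cases x <;> cases y <;> first | rfl | exact absurd rfl h

/-! ### Effect of the elementary operations on the components of a configuration -/

section Projections

variable {V : Type*} [DecidableEq V]

theorem assign_trail (I : Finset V) (c : Config V) (x : Idx) (l : Lit V) (r : Reason V) (y : Idx) :
    ((c.assign I x l r).sol y).trail =
      if y = x then ⟨l, c.level, r⟩ :: (c.sol y).trail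
      else if l.1 ∈ I then ⟨l, c.level, .ext⟩ :: (c.sol y).trail
      else (c.sol y).trail := rfl

theorem mem_assign_trail {I : Finset V} {c : Config V} {x : Idx} {l : Lit V} {r : Reason V}
    {y : Idx} {e : Entry V} : e ∈ ((c.assign I x l r).sol y).trail ↔
      e ∈ (c.sol y).trail ∨ (y = x ∧ e = ⟨l, c.level, r⟩) ∨
        (y ≠ x ∧ l.1 ∈ I ∧ e = ⟨l, c.level, .ext⟩) := by
  rw [assign_trail]
  split_ifs <;> simp_all [or_comm]

omit [DecidableEq V] in
theorem mem_backTo_trail {c : Config V} {b : ℕ} {y : Idx} {e : Entry V} :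
    e ∈ ((c.backTo b).sol y).trail ↔ e ∈ (c.sol y).trail ∧ e.level ≤ b := by
  simp [Config.backTo]

@[simp] theorem addClause_trail (c : Config V) (x : Idx) (C : Clause V) (p : ProofStep V)
    (y : Idx) : ((c.addClause x C p).sol y).trail = (c.sol y).trail := by
  unfold Config.addClause; split_ifs <;> rfl

@[simp] theorem addClause_mode (c : Config V) (x : Idx) (C : Clause V) (p : ProofStep V)
    (y : Idx) : ((c.addClause x C p).sol y).mode = (c.sol y).mode := by
  unfold Config.addClause; split_ifs <;> rfl

@[simp] theorem addClause_conflict (c : Config V) (x : Idx) (C : Clause V) (p : ProofStep V)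
    (y : Idx) : ((c.addClause x C p).sol y).conflict = (c.sol y).conflict := by
  unfold Config.addClause; split_ifs <;> rfl

@[simp] theorem addClause_level (c : Config V) (x : Idx) (C : Clause V) (p : ProofStep V) :
    (c.addClause x C p).level = c.level := by
  unfold Config.addClause; split_ifs <;> rfl

theorem mem_addClause_db {c : Config V} {x : Idx} {C : Clause V} {p : ProofStep V} {y : Idx}
    {D : Clause V} : D ∈ ((c.addClause x C p).sol y).db ↔
      D ∈ (c.sol y).db ∨ (y = x ∧ D = C) := by
  unfold Config.addClause
  split_ifs with h
  · constructor
    · exact Or.inl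
    · rintro (h' | ⟨rfl, rfl⟩)
      exacts [h', h]
  · by_cases hy : y = x
    · simp [hy, or_comm]
    · simp [hy]

@[simp] theorem copyTo_trail (c : Config V) (x : Idx) (C : Clause V) (y : Idx) :
    ((c.copyTo x C).sol y).trail = (c.sol y).trail := addClause_trail ..

@[simp] theorem copyTo_mode (c : Config V) (x : Idx) (C : Clause V) (y : Idx) :
    ((c.copyTo x C).sol y).mode = (c.sol y).mode := addClause_mode ..

@[simp] theorem copyTo_conflict (c : Config V) (x : Idx) (C : Clause V) (y : Idx) :
    ((c.copyTo x C).sol y).conflict = (c.sol y).conflict := addClause_conflict ..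

@[simp] theorem copyTo_level (c : Config V) (x : Idx) (C : Clause V) :
    (c.copyTo x C).level = c.level := addClause_level ..

theorem mem_copyTo_db {c : Config V} {x : Idx} {C : Clause V} {y : Idx}
    {D : Clause V} : D ∈ ((c.copyTo x C).sol y).db ↔
      D ∈ (c.sol y).db ∨ (y = x ∧ D = C) := mem_addClause_db

@[simp] theorem learn_trail (c : Config V) (x : Idx) (C : Clause V) (y : Idx) :
    ((c.learn x C).sol y).trail = (c.sol y).trail := addClause_trail ..

@[simp] theorem learn_mode (c : Config V) (x : Idx) (C : Clause V) (y : Idx) :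
    ((c.learn x C).sol y).mode = (c.sol y).mode := addClause_mode ..

@[simp] theorem learn_conflict (c : Config V) (x : Idx) (C : Clause V) (y : Idx) :
    ((c.learn x C).sol y).conflict = (c.sol y).conflict := addClause_conflict ..

theorem mem_learn_db {c : Config V} {x : Idx} {C : Clause V} {y : Idx}
    {D : Clause V} : D ∈ ((c.learn x C).sol y).db ↔
      D ∈ (c.sol y).db ∨ (y = x ∧ D = C) := mem_addClause_db

theorem setReason_trail (c : Config V) (x : Idx) (l : Lit V) (C : Clause V) (y : Idx) :
    ((c.setReason x l C).sol y).trail = if y = x then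
      (c.sol y).trail.map (fun e => if e.lit = l then { e with reason := .clause C } else e)
      else (c.sol y).trail := rfl

theorem mem_interface {Φ : Idx → Cnf V} {v : V} (h : v ∈ interface Φ) (x : Idx) :
    v ∈ vars (Φ x) := by
  rw [interface, Finset.mem_inter] at h
  cases x
  exacts [h.1, h.2]

end Projections

/-! ### The mode-independent invariant and its closure properties -/

section CoreInvariant

variable {V : Type*} [DecidableEq V] {Φ : Idx → Cnf V} {c : Config V}

/-- The invariants of trails, clause databases and log that hold in all modes. -/
structure Core (Φ : Idx → Cnf V) (c : Config V) : Prop where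
  wf : ∀ x, WF (c.sol x).trail
  level_le : ∀ x, ∀ e ∈ (c.sol x).trail, e.level ≤ c.level
  sync : ∀ x y, shPart (interface Φ) (c.sol x).trail = shPart (interface Φ) (c.sol y).trail
  ext : ∀ x, ∀ e ∈ (c.sol x).trail, e.reason = .ext → e.lit.1 ∈ interface Φ ∧
    ∃ a ∈ (c.sol x.other).trail, a.lit = e.lit ∧ a.reason ≠ .ext
  trail_vars : ∀ x, ∀ e ∈ (c.sol x).trail, e.lit.1 ∈ vars (Φ x)
  reason_mem : ∀ x, ∀ e ∈ (c.sol x).trail, ∀ R, e.reason = .clause R → R ∈ (c.sol x).db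
  db_vars : ∀ x, ∀ C ∈ (c.sol x).db, ∀ l ∈ C, l.1 ∈ vars (Φ x)
  input_mem : ∀ x, ∀ C ∈ Φ x, C ∈ (c.sol x).db
  act : ∀ x, actCls c.log x = {C | C ∈ (c.sol x).db}
  log_ok : LogOK Φ c.log

/-- `shPart` records levels along with literals, so synchronization transports both. -/
theorem Core.exists_shared (h : Core Φ c) {x : Idx} (y : Idx) {e : Entry V}
    (he : e ∈ (c.sol x).trail) (hI : e.lit.1 ∈ interface Φ) :
    ∃ a ∈ (c.sol y).trail, a.lit = e.lit ∧ a.level = e.level := by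
  have : (e.lit, e.level) ∈ shPart (interface Φ) (c.sol y).trail :=
    h.sync x y ▸ mem_shPart.2 ⟨hI, e, he, rfl, rfl⟩
  exact (mem_shPart.1 this).2

theorem Core.onTrail_shared (h : Core Φ c) {x : Idx} (y : Idx) {l : Lit V}
    (hl : OnTrail (c.sol x).trail l) (hI : l.1 ∈ interface Φ) : OnTrail (c.sol y).trail l := by
  obtain ⟨e, he, rfl⟩ := hl
  obtain ⟨a, ha, h', -⟩ := h.exists_shared y he hI
  exact ⟨a, ha, h'⟩

theorem Core.unassigned_shared (h : Core Φ c) {x : Idx} (y : Idx) {l : Lit V}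
    (hl : Unassigned (c.sol x).trail l) (hI : l.1 ∈ interface Φ) :
    Unassigned (c.sol y).trail l :=
  ⟨fun h' => hl.1 (h.onTrail_shared x h' hI), fun h' => hl.2 (h.onTrail_shared x h' hI)⟩

theorem Falsified.shared (h : Core Φ c) {x : Idx} (y : Idx) {C : Clause V}
    (hC : Falsified (c.sol x).trail C) (hI : SharedClause (interface Φ) C) :
    Falsified (c.sol y).trail C :=
  fun l hl => h.onTrail_shared y (hC l hl) (hI l hl)

theorem Core.falsified_vars (h : Core Φ c) {x : Idx} {C : Clause V}
    (hC : Falsified (c.sol x).trail C) : ∀ l ∈ C, l.1 ∈ vars (Φ x) := by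
  intro l hl
  obtain ⟨e, he, hel⟩ := hC l hl
  have := h.trail_vars x e he
  rwa [hel] at this

theorem Core.setConflict (h : Core Φ c) (x : Idx) (o : Option (Clause V)) :
    Core Φ (c.setConflict x o) :=
  ⟨h.wf, h.level_le, h.sync, h.ext, h.trail_vars, h.reason_mem, h.db_vars, h.input_mem, h.act,
    h.log_ok⟩

theorem Core.setModes (h : Core Φ c) (a b : Mode) : Core Φ (c.setModes a b) :=
  ⟨h.wf, h.level_le, h.sync, h.ext, h.trail_vars, h.reason_mem, h.db_vars, h.input_mem, h.act,
    h.log_ok⟩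

theorem Core.incLevel (h : Core Φ c) : Core Φ c.incLevel :=
  ⟨h.wf, fun x e he => Nat.le_succ_of_le (h.level_le x e he), h.sync, h.ext, h.trail_vars,
    h.reason_mem, h.db_vars, h.input_mem, h.act, h.log_ok⟩

/-- By synchronization a shared `l` is unassigned in both modules, so its external copy fits on the
other trail; `hext` makes the new entry of `x` the original that this copy must have. -/
theorem Core.assign (h : Core Φ c) {x : Idx} {l : Lit V} {r : Reason V} (hext : r ≠ .ext)
    (hv : l.1 ∈ vars (Φ x)) (hu : Unassigned (c.sol x).trail l)
    (hr : ∀ R, r = .clause R → R ∈ (c.sol x).db ∧ l ∈ R ∧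
      ∀ k ∈ R, k ≠ l → OnTrail (c.sol x).trail (neg k))
    (hd : r = .decision → 0 < c.level ∧ ∀ a ∈ (c.sol x).trail, a.level < c.level) :
    Core Φ (c.assign (interface Φ) x l r) where
  wf y := by
    rw [assign_trail]
    split_ifs with hy hI
    · subst hy
      exact ⟨hu, h.level_le y, fun R hR => (hr R hR).2, hd, h.wf y⟩
    · exact ⟨h.unassigned_shared y hu hI, h.level_le y, fun R hR => (by cases hR),
        fun hd => (by cases hd), h.wf y⟩
    · exact h.wf y
  level_le y e he := by
    rcases mem_assign_trail.1 he with he | ⟨-, rfl⟩ | ⟨-, -, rfl⟩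
    · exact h.level_le y e he
    · exact le_rfl
    · exact le_rfl
  sync := by
    have key : ∀ y, shPart (interface Φ) ((c.assign (interface Φ) x l r).sol y).trail =
        if l.1 ∈ interface Φ then (l, c.level) :: shPart (interface Φ) (c.sol y).trail
        else shPart (interface Φ) (c.sol y).trail := by
      intro y
      rw [assign_trail]
      split_ifs with h1 h2 h2 <;> simp [shPart_cons, h2]
    intro y z
    rw [key, key, h.sync y z]
  ext y e he hre := by
    rcases mem_assign_trail.1 he with he | ⟨rfl, rfl⟩ | ⟨hy, hI, rfl⟩
    · obtain ⟨h1, a, ha, h2⟩ := h.ext y e he hre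
      exact ⟨h1, a, mem_assign_trail.2 (Or.inl ha), h2⟩
    · exact absurd hre hext
    · refine ⟨hI, ⟨l, c.level, r⟩, mem_assign_trail.2 (Or.inr (Or.inl ⟨?_, rfl⟩)), rfl, hext⟩
      rw [Idx.eq_other_of_ne hy, Idx.other_other]
  trail_vars y e he := by
    rcases mem_assign_trail.1 he with he | ⟨rfl, rfl⟩ | ⟨hy, hI, rfl⟩
    · exact h.trail_vars y e he
    · exact hv
    · exact mem_interface hI y
  reason_mem y e he R hR := by
    rcases mem_assign_trail.1 he with he | ⟨rfl, rfl⟩ | ⟨hy, hI, rfl⟩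
    · exact h.reason_mem y e he R hR
    · exact (hr R hR).1
    · cases hR
  db_vars := h.db_vars
  input_mem := h.input_mem
  act := h.act
  log_ok := h.log_ok

theorem Core.backTo (h : Core Φ c) (b : ℕ) : Core Φ (c.backTo b) where
  wf x := (h.wf x).filter_level b
  level_le x e he := (mem_backTo_trail.1 he).2
  sync x y := by
    change shPart _ ((c.sol x).trail.filter _) = shPart _ ((c.sol y).trail.filter _)
    rw [shPart_filter_level, shPart_filter_level, h.sync x y]
  ext x e he hre := by
    obtain ⟨he, hb⟩ := mem_backTo_trail.1 he
    obtain ⟨hI, a, ha, hal, hre'⟩ := h.ext x e he hre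
    -- The original behind an external literal has the same level, so it survives the backjump as
    -- well.
    obtain ⟨a', ha', hal', hlev⟩ := h.exists_shared x.other he hI
    have := (h.wf _).eq_of_var_eq ha ha' (by rw [hal, hal'])
    subst this
    exact ⟨hI, a, mem_backTo_trail.2 ⟨ha, hlev ▸ hb⟩, hal, hre'⟩
  trail_vars x e he := h.trail_vars x e (mem_backTo_trail.1 he).1
  reason_mem x e he := h.reason_mem x e (mem_backTo_trail.1 he).1
  db_vars := h.db_vars
  input_mem := h.input_mem
  act := h.act
  log_ok := h.log_ok

theorem Core.delete (h : Core Φ c) {x : Idx} {C : Clause V} (hin : C ∉ Φ x)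
    (hlock : ∀ e ∈ (c.sol x).trail, e.reason ≠ .clause C) : Core Φ (c.delete x C) where
  wf := h.wf
  level_le := h.level_le
  sync := h.sync
  ext := h.ext
  trail_vars := h.trail_vars
  reason_mem y e he R hR := by
    have := h.reason_mem y e he R hR
    by_cases hy : y = x
    · subst hy
      simp only [Config.delete, if_true, Finset.mem_erase]
      exact ⟨fun e' => hlock e he (e' ▸ hR), this⟩
    · simpa [Config.delete, hy] using this
  db_vars y D hD := by
    refine h.db_vars y D ?_
    by_cases hy : y = x
    · simp only [Config.delete, hy, if_true, Finset.mem_erase] at hD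
      exact hy ▸ hD.2
    · simpa [Config.delete, hy] using hD
  input_mem y D hD := by
    have := h.input_mem y D hD
    by_cases hy : y = x
    · subst hy
      simp only [Config.delete, if_true, Finset.mem_erase]
      exact ⟨fun e => hin (e ▸ hD), this⟩
    · simpa [Config.delete, hy] using this
  act y := by
    ext D
    have hact : D ∈ actCls c.log y ↔ D ∈ (c.sol y).db := by rw [h.act]; rfl
    change D ∈ actCls (c.log ++ [.del x C]) y ↔ _
    rw [mem_actCls_append, hact]
    by_cases hy : y = x
    · subst hy
      simp [Config.delete, ProofStep.Adds, and_comm, eq_comm]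
    · simp [Config.delete, ProofStep.Adds, hy, Ne.symm hy]
  log_ok := h.log_ok.append trivial

/-- If `C` is already present, neither database nor log changes. Otherwise `hadd` and `hdel` ensure
that the logged step has the same effect on active clauses as the insertion has on the database. -/
theorem Core.addClause (h : Core Φ c) {x : Idx} {C : Clause V} {p : ProofStep V}
    (hv : ∀ l ∈ C, l.1 ∈ vars (Φ x)) (hp : StepOK c.log p)
    (hadd : ∀ y D, p.Adds y D ↔ y = x ∧ D = C) (hdel : ∀ y D, p ≠ .del y D) :
    Core Φ (c.addClause x C p) where
  wf y := by simpa using h.wf y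
  level_le y e he := by simpa using h.level_le y e (by simpa using he)
  sync y z := by simpa using h.sync y z
  ext y e he := by simpa using h.ext y e (by simpa using he)
  trail_vars y e he := h.trail_vars y e (by simpa using he)
  reason_mem y e he R hR :=
    mem_addClause_db.2 (Or.inl (h.reason_mem y e (by simpa using he) R hR))
  db_vars y D hD := by
    rcases mem_addClause_db.1 hD with hD | ⟨rfl, rfl⟩
    exacts [h.db_vars y D hD, hv]
  input_mem y D hD := mem_addClause_db.2 (Or.inl (h.input_mem y D hD))
  act y := by
    ext D
    have hact : D ∈ actCls c.log y ↔ D ∈ (c.sol y).db := by rw [h.act]; rfl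
    rw [Set.mem_ofPred_eq, mem_addClause_db]
    unfold Config.addClause
    split_ifs with hC
    · rw [hact]
      constructor
      · exact Or.inl
      · rintro (h | ⟨rfl, rfl⟩)
        exacts [h, hC]
    · rw [mem_actCls_append, hact, hadd]
      simp only [ne_eq, hdel, not_false_eq_true, and_true]
      tauto
  log_ok := by
    unfold Config.addClause
    split_ifs
    exacts [h.log_ok, h.log_ok.append hp]

theorem Core.learn (h : Core Φ c) {x : Idx} {C : Clause V}
    (hv : ∀ l ∈ C, l.1 ∈ vars (Φ x)) (hC : RUP {D | D ∈ (c.sol x).db} C) :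
    Core Φ (c.learn x C) :=
  h.addClause hv (show RUP (actCls c.log x) C by rwa [h.act])
    (fun y D => by simp [ProofStep.Adds, eq_comm]) (fun _ _ => by simp)

theorem Core.copyTo (h : Core Φ c) {x : Idx} {C : Clause V}
    (hv : SharedClause (interface Φ) C) (hC : RUP {D | D ∈ (c.sol x.other).db} C) :
    Core Φ (c.copyTo x C) :=
  h.addClause (fun l hl => mem_interface (hv l hl) x)
    (show RUP (actCls c.log x.other) C by rwa [h.act])
    (fun y D => by simp [ProofStep.Adds, eq_comm]) (fun _ _ => by simp)

omit [DecidableEq V] in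
theorem onTrail_map {t : List (Entry V)} {f : Entry V → Entry V} (hf : ∀ e, (f e).lit = e.lit)
    {l : Lit V} : OnTrail (t.map f) l ↔ OnTrail t l := by
  simp [OnTrail, hf]

/-- Only the entry of `l` gets a new obligation: `R` must imply `l` from older entries, which is why
`hR` refers to the tail of the splitting rather than to the whole trail. -/
theorem WF.map_setReason {t : List (Entry V)} (h : WF t) {l : Lit V} {R : Clause V}
    (hR : ∀ t₁ e t₂, t = t₁ ++ e :: t₂ → e.lit = l →
      l ∈ R ∧ ∀ k ∈ R, k ≠ l → OnTrail t₂ (neg k)) :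
    WF (t.map (fun e => if e.lit = l then { e with reason := .clause R } else e)) := by
  set f : Entry V → Entry V := fun e => if e.lit = l then { e with reason := .clause R } else e
    with hf
  have hlit : ∀ e, (f e).lit = e.lit := fun e => by simp only [hf]; split_ifs <;> rfl
  have hlev : ∀ e, (f e).level = e.level := fun e => by simp only [hf]; split_ifs <;> rfl
  have hfe : ∀ e, e.lit = l → (f e).reason = .clause R := fun e he => by simp [hf, he]
  have hfn : ∀ e, e.lit ≠ l → f e = e := fun e he => by simp [hf, he]
  clear_value f
  induction t with
  | nil => exact trivial
  | cons e t ih =>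
    have hlevs : ∀ P : ℕ → Prop, (∀ a ∈ t, P a.level) → ∀ a ∈ t.map f, P a.level := by
      intro P hP a ha
      obtain ⟨a', ha', rfl⟩ := List.mem_map.1 ha
      rw [hlev]
      exact hP a' ha'
    refine ⟨?_, ?_, ?_, ?_, ih h.tail fun t₁ a t₂ ht => hR (e :: t₁) a t₂ (by rw [ht]; rfl)⟩
    · rw [Unassigned, onTrail_map hlit, onTrail_map hlit, hlit]
      exact h.1
    · rw [hlev]
      exact hlevs (· ≤ e.level) h.2.1
    · intro R' hR'
      rw [hlit]
      simp only [onTrail_map hlit]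
      by_cases he : e.lit = l
      · rw [hfe e he, Reason.clause.injEq] at hR'
        subst hR'
        rw [he]
        exact hR [] e t rfl he
      · rw [hfn e he] at hR'
        exact h.2.2.1 R' hR'
    · intro hd
      by_cases he : e.lit = l
      · rw [hfe e he] at hd
        cases hd
      · rw [hfn e he] at hd ⊢
        exact ⟨(h.2.2.2.1 hd).1, hlevs (· < e.level) (h.2.2.2.1 hd).2⟩

theorem mem_setReason_trail {x y : Idx} {l : Lit V} {R : Clause V} {a : Entry V}
    (ha : a ∈ ((c.setReason x l R).sol y).trail) :
    ∃ e ∈ (c.sol y).trail, a.lit = e.lit ∧ a.level = e.level ∧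
      (a.reason = e.reason ∨ (y = x ∧ e.lit = l ∧ a.reason = .clause R)) := by
  rw [setReason_trail] at ha
  split_ifs at ha with hy
  · obtain ⟨e, he, rfl⟩ := List.mem_map.1 ha
    refine ⟨e, he, ?_⟩
    split_ifs with hl
    · exact ⟨rfl, rfl, Or.inr ⟨hy, hl, rfl⟩⟩
    · exact ⟨rfl, rfl, Or.inl rfl⟩
  · exact ⟨a, ha, rfl, rfl, Or.inl rfl⟩

theorem exists_mem_setReason_trail {x y : Idx} {l : Lit V} {R : Clause V} {e : Entry V}
    (he : e ∈ (c.sol y).trail) :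
    ∃ a ∈ ((c.setReason x l R).sol y).trail, a.lit = e.lit ∧ a.level = e.level ∧
      (a.reason = e.reason ∨ a.reason = .clause R) := by
  rw [setReason_trail]
  split_ifs with hy
  · refine ⟨_, List.mem_map_of_mem he, ?_⟩
    split_ifs with hl
    · exact ⟨rfl, rfl, Or.inr rfl⟩
    · exact ⟨rfl, rfl, Or.inl rfl⟩
  · exact ⟨e, he, rfl, rfl, Or.inl rfl⟩

theorem onTrail_setReason {x y : Idx} {l k : Lit V} {R : Clause V} :
    OnTrail ((c.setReason x l R).sol y).trail k ↔ OnTrail (c.sol y).trail k := by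
  constructor
  · rintro ⟨a, ha, rfl⟩
    obtain ⟨e, he, h, -⟩ := mem_setReason_trail ha
    exact ⟨e, he, h.symm⟩
  · rintro ⟨e, he, rfl⟩
    obtain ⟨a, ha, h, -⟩ := exists_mem_setReason_trail (x := x) (l := l) (R := R) he
    exact ⟨a, ha, h⟩

theorem shPart_map {I : Finset V} {t : List (Entry V)} {f : Entry V → Entry V}
    (hf : ∀ e, (f e).lit = e.lit ∧ (f e).level = e.level) :
    shPart I (t.map f) = shPart I t := by
  induction t with
  | nil => rfl
  | cons e t ih => rw [List.map_cons, shPart_cons, shPart_cons, ih, (hf e).1, (hf e).2]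

/-- On the other trail the remaining literals of `R` were falsified before `l`. They are shared, and
shared literals occur in the same order on both trails, so they were falsified before `l` here too.
-/
theorem Core.setReason (h : Core Φ c) {x : Idx} {l : Lit V} {R : Clause V}
    (hR : R ∈ (c.sol x).db)
    (hl : InterfaceReason (interface Φ) (c.sol x.other).trail l R) :
    Core Φ (c.setReason x l R) where
  wf y := by
    rw [setReason_trail]
    split_ifs with hy
    · subst hy
      refine (h.wf y).map_setReason fun t₁ e t₂ ht he => ?_
      obtain ⟨hI, hlR, u₁, a, u₂, hu, ha, hk⟩ := hl.spec (h.wf _)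
      refine ⟨hlR, fun k hkR hkl => ?_⟩
      have hs := h.sync y.other y
      rw [hu, ht] at hs
      exact before_of_shPart_eq (hu ▸ h.wf y.other) hs (ha.trans he.symm) (ha ▸ hI l hlR)
        (hI k hkR) (hk k hkR hkl)
    · exact h.wf y
  level_le y a ha := by
    obtain ⟨e, he, -, h2, -⟩ := mem_setReason_trail ha
    exact h2 ▸ h.level_le y e he
  sync := by
    have key : ∀ y, shPart (interface Φ) ((c.setReason x l R).sol y).trail =
        shPart (interface Φ) (c.sol y).trail := by
      intro y
      rw [setReason_trail]
      split_ifs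
      · exact shPart_map fun e => by split_ifs <;> exact ⟨rfl, rfl⟩
      · rfl
    intro y z
    rw [key, key, h.sync y z]
  ext y a ha hext := by
    obtain ⟨e, he, h1, -, h3⟩ := mem_setReason_trail ha
    rcases h3 with h3 | ⟨-, -, h3⟩
    · obtain ⟨hI, b, hb, hbl, hbr⟩ := h.ext y e he (h3 ▸ hext)
      obtain ⟨b', hb', hbl', -, hbr'⟩ := exists_mem_setReason_trail (x := x) (l := l) (R := R) hb
      refine ⟨h1 ▸ hI, b', hb', by rw [hbl', hbl, h1], ?_⟩
      rcases hbr' with e | e <;> rw [e]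
      · exact hbr
      · simp
    · rw [h3] at hext
      cases hext
  trail_vars y a ha := by
    obtain ⟨e, he, h1, -⟩ := mem_setReason_trail ha
    exact h1 ▸ h.trail_vars y e he
  reason_mem y a ha R' hR' := by
    obtain ⟨e, he, -, -, h3⟩ := mem_setReason_trail ha
    rcases h3 with h3 | ⟨rfl, -, h3⟩
    · exact h.reason_mem y e he R' (h3 ▸ hR')
    · rw [h3, Reason.clause.injEq] at hR'
      exact hR' ▸ hR
  db_vars := h.db_vars
  input_mem := h.input_mem
  act := h.act
  log_ok := h.log_ok

/-- A conflict clause that is asserting below its highest literal becomes unit by backjumping. -/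
theorem Core.backjump (h : Core Φ c) {x : Idx} {C : Clause V} {e : Entry V} {b : ℕ}
    (hf : Falsified (c.sol x).trail C) (hC : RUP {D | D ∈ (c.sol x).db} C)
    (ha : Asserting (c.sol x).trail C e b) :
    Core Φ (c.backjump (interface Φ) x C (neg e.lit) b) := by
  obtain ⟨he, heC, hb, hrest⟩ := ha
  have hcore : Core Φ (((c.setConflict x none).learn x C).backTo b) :=
    ((h.setConflict x none).learn (h.falsified_vars hf) hC).backTo b
  refine hcore.assign (by simp) (h.trail_vars x e he) ?_ ?_ (by simp)
  · rw [unassigned_iff]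
    intro a ha hal
    obtain ⟨ha, hab⟩ := mem_backTo_trail.1 ha
    have : a ∈ (c.sol x).trail := by simpa [Config.setConflict] using ha
    have := (h.wf x).eq_of_var_eq this he hal
    subst this
    omega
  · rintro R hR
    rw [Reason.clause.injEq] at hR
    subst hR
    refine ⟨mem_learn_db.2 (Or.inr ⟨rfl, rfl⟩), heC, fun k hk hke => ?_⟩
    obtain ⟨a, ha, hak⟩ := hf k hk
    refine ⟨a, mem_backTo_trail.2 ⟨by simpa [Config.setConflict] using ha, ?_⟩, hak⟩
    refine hrest a ha (by rwa [hak, neg_neg]) fun h' => hke ?_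
    rw [← h', hak, neg_neg]

/-- The variable of `l` was assigned above `i`, so the backjump frees it; the level is raised before
deciding, so the decision lies strictly above everything kept. -/
theorem Core.refine (h : Core Φ c) {i : ℕ} {l : Lit V} {e : Entry V}
    (he : e ∈ (c.sol .m).trail) (hl : l.1 = e.lit.1) (hlev : i < e.level) :
    Core Φ (c.refine (interface Φ) i l) := by
  have hcore : Core Φ ((((((c.setConflict .s none).setConflict .m none).backTo i).setModes
      .propagate (.decide 0)).incLevel)) :=
    ((((h.setConflict _ _).setConflict _ _).backTo i).setModes _ _).incLevel
  refine hcore.assign (by simp) (hl ▸ h.trail_vars .m e he) ?_ (by simp) ?_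
  · rw [unassigned_iff]
    intro a ha hal
    obtain ⟨ha, hab⟩ := mem_backTo_trail.1 ha
    have := (h.wf .m).eq_of_var_eq ha he (hal.trans hl)
    subst this
    omega
  · exact fun _ => ⟨Nat.succ_pos _, fun a ha => Nat.lt_succ_of_le (mem_backTo_trail.1 ha).2⟩

end CoreInvariant

/-! ### The mode-dependent invariant -/

section Invariant

variable {V : Type*} [DecidableEq V] {Φ : Idx → Cnf V} {c c' : Config V}

/-- Every positive level up to the current one is inhabited. -/
def Covered (c : Config V) : Prop :=
  ∀ k, 1 ≤ k → k ≤ c.level → ∃ x, ∃ e ∈ (c.sol x).trail, e.level = k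

/-- The invariants of the four combinations of search modes. -/
inductive ModeInv (Φ : Idx → Cnf V) (c : Config V) : Prop where
  | normal (hmode : c.Normal) (hdec : ∀ e ∈ (c.sol .s).trail, e.reason ≠ .decision)
  | exploring (i : ℕ) (hs : (c.sol .s).mode = .decide i) (hm : (c.sol .m).mode = .finished)
      (hi : i ≤ c.level)
      (hdec : ∀ e ∈ (c.sol .s).trail, e.reason = .decision → i < e.level)
      (hlev : ∀ e ∈ (c.sol .m).trail, e.level ≤ i)
      (hsat : FullSat (vars (Φ .m)) (c.sol .m)) (hconf : (c.sol .m).conflict = none)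
  | speculating (i : ℕ) (hs : (c.sol .s).mode = .decide i) (hm : (c.sol .m).mode = .propagate)
      (hi : i ≤ c.level)
      (hdec : ∀ e ∈ (c.sol .s).trail, e.reason = .decision → i < e.level)
      (hdec' : ∀ e ∈ (c.sol .m).trail, e.reason = .decision → e.level ≤ i)
  | validating (i j : ℕ) (hs : (c.sol .s).mode = .finished)
      (hm : (c.sol .m).mode = .validate i j) (hi : i ≤ j) (hj : j ≤ c.level)
      (hdec : ∀ e ∈ (c.sol .s).trail, e.reason = .decision → i < e.level)
      (hdec' : ∀ e ∈ (c.sol .m).trail, e.reason = .decision → e.level ≤ i ∨ j < e.level)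
      (hlev : ∀ e ∈ (c.sol .s).trail, e.level ≤ j)
      (hsat : FullSat (vars (Φ .s)) (c.sol .s)) (hconf : (c.sol .s).conflict = none)

/-- The invariant of SpecSMS. -/
structure Inv (Φ : Idx → Cnf V) (c : Config V) : Prop where
  core : Core Φ c
  covered : Covered c
  conflict : ∀ x C, (c.sol x).conflict = some C →
    Falsified (c.sol x).trail C ∧ RUP {D | D ∈ (c.sol x).db} C ∧
      (c.sol x.other).conflict = none
  modes : ModeInv Φ c

omit [DecidableEq V] in
theorem Covered.mono (h : Covered c) (hlev : c'.level ≤ c.level)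
    (ht : ∀ x, ∀ e ∈ (c.sol x).trail, e.level ≤ c'.level →
      ∃ a ∈ (c'.sol x).trail, a.level = e.level) : Covered c' := by
  intro k hk hkl
  obtain ⟨x, e, he, rfl⟩ := h k hk (hkl.trans hlev)
  exact ⟨x, ht x e he hkl⟩

theorem Covered.incLevel_assign (h : Covered c) (I : Finset V) (x : Idx) (l : Lit V)
    (r : Reason V) : Covered (c.incLevel.assign I x l r) := by
  intro k hk hkl
  rcases Nat.lt_or_eq_of_le hkl with hkl | rfl
  · obtain ⟨y, e, he, hek⟩ := h k hk (Nat.le_of_lt_succ hkl)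
    exact ⟨y, e, mem_assign_trail.2 (Or.inl he), hek⟩
  · exact ⟨x, _, mem_assign_trail.2 (Or.inr (Or.inl ⟨rfl, rfl⟩)), rfl⟩

omit [DecidableEq V] in
theorem Covered.backTo (h : Covered c) {b : ℕ} (hb : b ≤ c.level) : Covered (c.backTo b) :=
  h.mono hb fun _ e he hl => ⟨e, mem_backTo_trail.2 ⟨he, hl⟩, rfl⟩

theorem Covered.backjump (h : Covered c) {b : ℕ} (hb : b ≤ c.level) (I : Finset V) (x : Idx)
    (C : Clause V) (l : Lit V) : Covered (c.backjump I x C l b) :=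
  h.mono hb fun y e he hl => ⟨e, mem_assign_trail.2 (Or.inl (mem_backTo_trail.2
    ⟨by simpa [Config.setConflict] using he, hl⟩)), rfl⟩

omit [DecidableEq V] in
theorem FullSat.mono {vs : Finset V} {a b : Solver V} (h : FullSat vs a) (hdb : b.db ⊆ a.db)
    (ht : ∀ e ∈ a.trail, ∃ e' ∈ b.trail, e'.lit = e.lit) : FullSat vs b := by
  refine ⟨fun v hv => ?_, fun C hC => ?_⟩
  · obtain ⟨e, he, rfl⟩ := h.1 v hv
    obtain ⟨e', he', h'⟩ := ht e he
    exact ⟨e', he', by rw [h']⟩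
  · obtain ⟨l, hl, e, he, rfl⟩ := h.2 C (hdb hC)
    obtain ⟨e', he', h'⟩ := ht e he
    exact ⟨_, hl, e', he', h'⟩

theorem FullSat.not_falsified (hc : Core Φ c) {x : Idx} (h : FullSat (vars (Φ x)) (c.sol x))
    {C : Clause V} (hC : C ∈ (c.sol x).db) : ¬ Falsified (c.sol x).trail C := fun hf =>
  let ⟨l, hl, hl'⟩ := h.2 C hC
  (hc.wf x).not_onTrail_neg hl' (hf l hl)

/-- A module with a full assignment has assigned all shared variables. Hence assignments made by the
other module are local and leave the finished trail alone. -/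
theorem FullSat.not_shared (hc : Core Φ c) {x y : Idx} (h : FullSat (vars (Φ y)) (c.sol y))
    {l : Lit V} (hu : Unassigned (c.sol x).trail l) : l.1 ∉ interface Φ := fun hI => by
  obtain ⟨e, he, hel⟩ := h.1 l.1 (mem_interface hI y)
  exact unassigned_iff.1 (hc.unassigned_shared y hu hI) e he hel

/-- No joint full satisfying assignment exists for an unsatisfiable input. -/
theorem FullSat.satBy (hc : Core Φ c) (h : ∀ x, FullSat (vars (Φ x)) (c.sol x)) :
    ∃ τ : V → Bool, (Φ .s).SatBy τ ∧ (Φ .m).SatBy τ := by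
  classical
  -- Variables of `Φ .s` are read off the trail of `s`, all others off that of `m`. The choice is
  -- harmless, since true shared literals are on both trails (`hon`).
  let τ : V → Bool := fun v =>
    decide (OnTrail (c.sol (if v ∈ vars (Φ .s) then .s else .m)).trail (v, true))
  have hon : ∀ x l, OnTrail (c.sol x).trail l → OnTrail (c.sol
      (if l.1 ∈ vars (Φ .s) then .s else .m)).trail l := by
    intro x l hl
    have hx : l.1 ∈ vars (Φ x) := by
      obtain ⟨e, he, rfl⟩ := hl
      exact hc.trail_vars x e he
    split_ifs with hs
    · cases x
      · exact hl
      · exact hc.onTrail_shared _ hl (Finset.mem_inter.2 ⟨hs, hx⟩)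
    · cases x
      · exact absurd hx hs
      · exact hl
  have key : ∀ x l, OnTrail (c.sol x).trail l → τ l.1 = l.2 := by
    rintro x ⟨v, p⟩ hl
    have hl' := hon x _ hl
    cases p
    · exact decide_eq_false fun h => (hc.wf _).not_onTrail_neg h hl'
    · exact decide_eq_true hl'
  refine ⟨τ, ?_, ?_⟩ <;> intro C hC <;>
    obtain ⟨l, hl, hl'⟩ := (h _).2 C (hc.input_mem _ C hC) <;> exact ⟨l, hl, key _ l hl'⟩

/-- This serves transitions that add no entries or decisions. `hsat` concerns only conflict-free
modules with a full assignment, the only ones about which `ModeInv` makes such a claim. -/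
theorem ModeInv.congr (h : ModeInv Φ c) (hmode : ∀ y, (c'.sol y).mode = (c.sol y).mode)
    (hlevel : c'.level = c.level)
    (ht : ∀ y, ∀ a ∈ (c'.sol y).trail, ∃ e ∈ (c.sol y).trail, a.level = e.level ∧
      (a.reason = .decision → e.reason = .decision))
    (hsat : ∀ y, FullSat (vars (Φ y)) (c.sol y) → (c.sol y).conflict = none →
      FullSat (vars (Φ y)) (c'.sol y) ∧ (c'.sol y).conflict = none) : ModeInv Φ c' := by
  have key : ∀ y (P : ℕ → Prop), (∀ e ∈ (c.sol y).trail, e.reason = .decision → P e.level) →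
      ∀ a ∈ (c'.sol y).trail, a.reason = .decision → P a.level := by
    intro y P hP a ha hd
    obtain ⟨e, he, hl, hr⟩ := ht y a ha
    exact hl ▸ hP e he (hr hd)
  have key' : ∀ y (P : ℕ → Prop), (∀ e ∈ (c.sol y).trail, P e.level) →
      ∀ a ∈ (c'.sol y).trail, P a.level := by
    intro y P hP a ha
    obtain ⟨e, he, hl, -⟩ := ht y a ha
    exact hl ▸ hP e he
  cases h with
  | normal hm hd =>
    exact .normal ⟨by rw [hmode, hm.1], by rw [hmode, hm.2]⟩
      fun a ha hd' => key .s (fun _ => False) (fun e he => hd e he) a ha hd'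
  | exploring i hs hm hi hd hlev hsat' hconf =>
    exact .exploring i (by rw [hmode, hs]) (by rw [hmode, hm]) (hlevel ▸ hi)
      (key .s (i < ·) hd) (key' .m (· ≤ i) hlev) (hsat .m hsat' hconf).1 (hsat .m hsat' hconf).2
  | speculating i hs hm hi hd hd' =>
    exact .speculating i (by rw [hmode, hs]) (by rw [hmode, hm]) (hlevel ▸ hi)
      (key .s (i < ·) hd) (key .m (· ≤ i) hd')
  | validating i j hs hm hi hj hd hd' hlev hsat' hconf =>
    exact .validating i j (by rw [hmode, hs]) (by rw [hmode, hm]) hi (hlevel ▸ hj)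
      (key .s (i < ·) hd) (key .m (fun n => n ≤ i ∨ j < n) hd') (key' .s (· ≤ j) hlev)
      (hsat .s hsat' hconf).1 (hsat .s hsat' hconf).2

theorem Inv.of_no_conflict (h1 : Core Φ c) (h2 : Covered c)
    (h3 : ∀ x, (c.sol x).conflict = none) (h4 : ModeInv Φ c) : Inv Φ c :=
  ⟨h1, h2, fun x C h => absurd h (by simp [h3]), h4⟩

theorem decision_of_mem_assign {I : Finset V} {x y : Idx} {l : Lit V} {r : Reason V} {a : Entry V}
    (ha : a ∈ ((c.assign I x l r).sol y).trail) (hd : a.reason = .decision) :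
    a ∈ (c.sol y).trail ∨ (y = x ∧ r = .decision ∧ a.level = c.level) := by
  rcases mem_assign_trail.1 ha with h | ⟨hy, rfl⟩ | ⟨-, -, rfl⟩
  · exact Or.inl h
  · exact Or.inr ⟨hy, hd, rfl⟩
  · cases hd

theorem mem_assign_trail_of_local {I : Finset V} {x y : Idx} {l : Lit V} {r : Reason V}
    {a : Entry V} (hy : y ≠ x) (hI : l.1 ∉ I) :
    a ∈ ((c.assign I x l r).sol y).trail ↔ a ∈ (c.sol y).trail := by
  rw [assign_trail, if_neg hy, if_neg hI]

theorem FullSat.assign {vs : Finset V} {y : Idx} (h : FullSat vs (c.sol y)) (I : Finset V)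
    (x : Idx) (l : Lit V) (r : Reason V) : FullSat vs ((c.assign I x l r).sol y) :=
  h.mono subset_rfl fun e he => ⟨e, mem_assign_trail.2 (Or.inl he), rfl⟩

/-- No decision is created, so only the level bound on the trail of a finished module needs care; by
`FullSat.not_shared` that trail is unchanged. -/
theorem ModeInv.propagate (hc : Core Φ c) (h : ModeInv Φ c) {x : Idx} {l : Lit V} {C : Clause V}
    (hmode : (c.sol x).mode ≠ .finished) (hu : Unassigned (c.sol x).trail l) :
    ModeInv Φ (c.assign (interface Φ) x l (.clause C)) := by
  have hd : ∀ y, ∀ a ∈ ((c.assign (interface Φ) x l (.clause C)).sol y).trail,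
      a.reason = .decision → a ∈ (c.sol y).trail := by
    intro y a ha had
    rcases decision_of_mem_assign ha had with h | ⟨-, h, -⟩
    · exact h
    · cases h
  cases h with
  | normal hm hdec => exact .normal hm fun a ha had => hdec a (hd _ a ha had) had
  | exploring i hs hm hi hdec hlev hsat hconf =>
    refine .exploring i hs hm hi (fun a ha had => hdec a (hd _ a ha had) had)
      (fun a ha => ?_) (hsat.assign ..) hconf
    exact hlev a ((mem_assign_trail_of_local (by rintro rfl; exact hmode hm)
      (hsat.not_shared hc hu)).1 ha)
  | speculating i hs hm hi hdec hdec' =>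
    exact .speculating i hs hm hi (fun a ha had => hdec a (hd _ a ha had) had)
      (fun a ha had => hdec' a (hd _ a ha had) had)
  | validating i j hs hm hi hj hdec hdec' hlev hsat hconf =>
    refine .validating i j hs hm hi hj (fun a ha had => hdec a (hd _ a ha had) had)
      (fun a ha had => hdec' a (hd _ a ha had) had) (fun a ha => ?_) (hsat.assign ..) hconf
    exact hlev a ((mem_assign_trail_of_local (by rintro rfl; exact hmode hs)
      (hsat.not_shared hc hu)).1 ha)

/-- The new decision has level `c.level + 1`, beyond the bounds `i` and `j`, and modules in mode `P`
or `F` do not decide. -/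
theorem ModeInv.decide (hc : Core Φ c) (h : ModeInv Φ c) {x : Idx} {l : Lit V}
    (hmode : (∃ i, (c.sol x).mode = .decide i) ∨ ∃ i j, (c.sol x).mode = .validate i j)
    (hu : Unassigned (c.sol x).trail l) :
    ModeInv Φ (c.incLevel.assign (interface Φ) x l .decision) := by
  have hd : ∀ y, ∀ a ∈ ((c.incLevel.assign (interface Φ) x l .decision).sol y).trail,
      a.reason = .decision → a ∈ (c.sol y).trail ∨ (y = x ∧ a.level = c.level + 1) := by
    intro y a ha had
    rcases decision_of_mem_assign ha had with h | ⟨h1, -, h2⟩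
    · exact Or.inl h
    · exact Or.inr ⟨h1, h2⟩
  have hx : ∀ y, (c.sol y).mode = .propagate ∨ (c.sol y).mode = .finished → y ≠ x := by
    rintro y hy rfl
    rcases hmode with ⟨i, h⟩ | ⟨i, j, h⟩ <;> rw [h] at hy <;> simp at hy
  cases h with
  | normal hm hdec =>
    refine .normal hm fun a ha had => ?_
    rcases hd _ a ha had with h | ⟨h, -⟩
    · exact hdec a h had
    · exact hx .s (Or.inl hm.1) h
  | exploring i hs hm hi hdec hlev hsat hconf =>
    refine .exploring i hs hm (Nat.le_succ_of_le hi) (fun a ha had => ?_)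
      (fun a ha => ?_) (FullSat.assign (c := c.incLevel) hsat ..) hconf
    · rcases hd _ a ha had with h | ⟨-, h⟩
      · exact hdec a h had
      · omega
    · exact hlev a ((mem_assign_trail_of_local (c := c.incLevel) (hx .m (Or.inr hm)) (hsat.not_shared hc hu)).1 ha)
  | speculating i hs hm hi hdec hdec' =>
    refine .speculating i hs hm (Nat.le_succ_of_le hi) (fun a ha had => ?_) (fun a ha had => ?_)
    · rcases hd _ a ha had with h | ⟨-, h⟩
      · exact hdec a h had
      · omega
    · rcases hd _ a ha had with h | ⟨h, -⟩
      · exact hdec' a h had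
      · exact absurd h (hx .m (Or.inl hm))
  | validating i j hs hm hi hj hdec hdec' hlev hsat hconf =>
    refine .validating i j hs hm hi (Nat.le_succ_of_le hj) (fun a ha had => ?_)
      (fun a ha had => ?_) (fun a ha => ?_) (FullSat.assign (c := c.incLevel) hsat ..) hconf
    · rcases hd _ a ha had with h | ⟨h, -⟩
      · exact hdec a h had
      · exact absurd h (hx .s (Or.inr hs))
    · rcases hd _ a ha had with h | ⟨-, h⟩
      · exact hdec' a h had
      · omega
    · exact hlev a ((mem_assign_trail_of_local (c := c.incLevel) (hx .s (Or.inr hs)) (hsat.not_shared hc hu)).1 ha)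

theorem mem_backjump_trail {I : Finset V} {x y : Idx} {C : Clause V} {l : Lit V} {b : ℕ}
    {a : Entry V} (ha : a ∈ ((c.backjump I x C l b).sol y).trail) :
    (a ∈ (c.sol y).trail ∧ a.level ≤ b) ∨
      (a.level = b ∧ a.reason ≠ .decision ∧ (y = x ∨ l.1 ∈ I)) := by
  rcases mem_assign_trail.1 ha with h | ⟨hy, rfl⟩ | ⟨-, hI, rfl⟩
  · exact Or.inl (by simpa [Config.setConflict] using mem_backTo_trail.1 h)
  · exact Or.inr ⟨rfl, by simp, Or.inl hy⟩
  · exact Or.inr ⟨rfl, by simp, Or.inr hI⟩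

theorem decision_of_mem_backjump {I : Finset V} {x y : Idx} {C : Clause V} {l : Lit V} {b : ℕ}
    {a : Entry V} (ha : a ∈ ((c.backjump I x C l b).sol y).trail) (hd : a.reason = .decision) :
    a ∈ (c.sol y).trail ∧ a.level ≤ b := by
  rcases mem_backjump_trail ha with h | ⟨-, h, -⟩
  exacts [h, absurd hd h]

theorem mem_backjump_of_le {I : Finset V} {x y : Idx} {C : Clause V} {l : Lit V} {b : ℕ}
    {a : Entry V} (ha : a ∈ (c.sol y).trail) (hb : a.level ≤ b) :
    a ∈ ((c.backjump I x C l b).sol y).trail :=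
  mem_assign_trail.2 (Or.inl (mem_backTo_trail.2 ⟨by simpa [Config.setConflict] using ha, hb⟩))

@[simp] theorem backjump_mode (c : Config V) (I : Finset V) (x y : Idx) (C : Clause V)
    (l : Lit V) (b : ℕ) : ((c.backjump I x C l b).sol y).mode = (c.sol y).mode :=
  learn_mode (c.setConflict x none) x C y

theorem backjump_conflict (c : Config V) (I : Finset V) (x y : Idx) (C : Clause V)
    (l : Lit V) (b : ℕ) : ((c.backjump I x C l b).sol y).conflict =
      if y = x then none else (c.sol y).conflict :=
  learn_conflict (c.setConflict x none) x C y

/-- A module with a full satisfying assignment keeps it when the other module backjumps above the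
levels of this assignment. -/
theorem FullSat.backjump (hc : Core Φ c) {x y : Idx} (hy : y ≠ x)
    (h : FullSat (vars (Φ y)) (c.sol y)) {C : Clause V} {e : Entry V} {b n : ℕ}
    (hlev : ∀ a ∈ (c.sol y).trail, a.level ≤ n) (hn : n ≤ b)
    (ha : Asserting (c.sol x).trail C e b) :
    FullSat (vars (Φ y)) ((c.backjump (interface Φ) x C (neg e.lit) b).sol y) ∧
      ∀ a ∈ ((c.backjump (interface Φ) x C (neg e.lit) b).sol y).trail, a.level ≤ n := by
  constructor
  · refine h.mono (fun D hD => ?_) fun a ha =>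
      ⟨a, mem_backjump_of_le ha ((hlev a ha).trans hn), rfl⟩
    rcases mem_learn_db.1 (show D ∈ (((c.setConflict x none).learn x C).sol y).db from hD) with
      h | ⟨h, -⟩
    exacts [h, absurd h hy]
  · intro a ha'
    rcases mem_backjump_trail ha' with ⟨h, -⟩ | ⟨-, -, h | hI⟩
    · exact hlev a h
    · exact absurd h hy
    · obtain ⟨e', he', -, hl⟩ := hc.exists_shared y ha.1 hI
      have := hlev e' he'
      have := ha.2.2.1
      omega

theorem Inv.backjump (h : Inv Φ c) {x : Idx} {C : Clause V} {e : Entry V} {b : ℕ}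
    (hC : (c.sol x).conflict = some C) (ha : Asserting (c.sol x).trail C e b) :
    Core Φ (c.backjump (interface Φ) x C (neg e.lit) b) ∧
      Covered (c.backjump (interface Φ) x C (neg e.lit) b) ∧
      ∀ y, ((c.backjump (interface Φ) x C (neg e.lit) b).sol y).conflict = none := by
  obtain ⟨hf, hr, ho⟩ := h.conflict x C hC
  refine ⟨h.core.backjump hf hr ha, h.covered.backjump
    (ha.2.2.1.le.trans (h.core.level_le x e ha.1)) _ _ _ _, fun y => ?_⟩
  rw [backjump_conflict]
  split_ifs with hy
  · rfl
  · rwa [Idx.eq_other_of_ne hy]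

theorem mem_refine_trail {I : Finset V} {y : Idx} {l : Lit V} {i : ℕ} {a : Entry V}
    (ha : a ∈ ((c.refine I i l).sol y).trail) :
    (a ∈ (c.sol y).trail ∧ a.level ≤ i) ∨ (a.level = i + 1 ∧ (y ≠ .m → a.reason = .ext)) := by
  rcases mem_assign_trail.1 ha with h | ⟨hy, rfl⟩ | ⟨-, hI, rfl⟩
  · exact Or.inl (mem_backTo_trail.1 h)
  · exact Or.inr ⟨rfl, fun h => absurd hy h⟩
  · exact Or.inr ⟨rfl, fun _ => rfl⟩

/-- Every decision of `s` lies above `i` and disappears, and the new decision of `m` can reach `s`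
only as an external literal. So `s` has no decisions, as normal execution demands. -/
theorem Inv.refine (h : Inv Φ c) {i : ℕ} {l : Lit V} {e : Entry V}
    (he : e ∈ (c.sol .m).trail) (hl : l.1 = e.lit.1) (hlev : i < e.level)
    (hdec : ∀ e ∈ (c.sol .s).trail, e.reason = .decision → i < e.level) :
    Inv Φ (c.refine (interface Φ) i l) := by
  refine .of_no_conflict (h.core.refine he hl hlev) ?_ ?_ (.normal ⟨rfl, rfl⟩ ?_)
  · exact Covered.incLevel_assign (c := (((c.setConflict .s none).setConflict .m none).backTo
      i).setModes .propagate (.decide 0))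
      (h.covered.backTo (hlev.le.trans (h.core.level_le .m e he))) _ _ _ _
  · rintro (_ | _) <;> rfl
  · intro a ha hd
    rcases mem_refine_trail ha with ⟨h1, h2⟩ | ⟨-, h⟩
    · have := hdec a h1 hd
      omega
    · rw [h (by decide)] at hd
      cases hd

/-- Back to normal execution with a conflict in the main module. -/
theorem Inv.blocked (h1 : Core Φ c) (h2 : Covered c) {i : ℕ} {C : Clause V} (hi : i ≤ c.level)
    (hdec : ∀ e ∈ (c.sol .s).trail, e.reason = .decision → i < e.level)
    (hs : (c.sol .s).conflict = none) (hm : (c.sol .m).conflict = some C)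
    (hf : Falsified (c.sol .m).trail C) (hC : RUP {D | D ∈ (c.sol .m).db} C)
    (hlev : LevelsLE (c.sol .m).trail C i) :
    Inv Φ ((c.backTo i).setModes .propagate (.decide 0)) where
  core := (h1.backTo i).setModes _ _
  covered := h2.backTo hi
  conflict x D hD := by
    cases x with
    | s => exact absurd (hs.symm.trans hD) (by simp)
    | m =>
      have := hm.symm.trans hD
      rw [Option.some.injEq] at this
      subst this
      refine ⟨fun l hl => ?_, hC, hs⟩
      obtain ⟨a, ha, hal⟩ := hf l hl
      exact ⟨a, mem_backTo_trail.2 ⟨ha, hlev a ha (by rwa [hal, neg_neg])⟩, hal⟩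
  modes := .normal ⟨rfl, rfl⟩ fun a ha hd => by
    obtain ⟨ha, hl⟩ := mem_backTo_trail.1 ha
    have := hdec a ha hd
    omega

theorem ModeInv.decision_lt (h : ModeInv Φ c) {i : ℕ} (hs : (c.sol .s).mode = .decide i) :
    i ≤ c.level ∧ ∀ e ∈ (c.sol .s).trail, e.reason = .decision → i < e.level := by
  cases h with
  | normal hm _ => rw [hm.1] at hs; cases hs
  | exploring j hs' _ hi hd =>
    rw [hs', Mode.decide.injEq] at hs
    exact hs ▸ ⟨hi, hd⟩
  | speculating j hs' _ hi hd =>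
    rw [hs', Mode.decide.injEq] at hs
    exact hs ▸ ⟨hi, hd⟩
  | validating i j hs' => rw [hs'] at hs; cases hs

/-- A module takes over a shared conflict clause. -/
theorem Inv.transfer (h : Inv Φ c) {x y : Idx} (hxy : y = x.other) {C : Clause V}
    (hC : (c.sol x).conflict = some C) (hI : SharedClause (interface Φ) C) :
    Core Φ (((c.copyTo y C).setConflict x none).setConflict y (some C)) ∧
      Falsified (c.sol y).trail C ∧
      RUP {D | D ∈ ((((c.copyTo y C).setConflict x none).setConflict y (some C)).sol y).db} C := by
  obtain ⟨hf, hr, -⟩ := h.conflict x C hC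
  refine ⟨((h.core.copyTo hI ?_).setConflict _ _).setConflict _ _, hf.shared h.core y hI,
    .of_mem (mem_copyTo_db.2 (Or.inr ⟨rfl, rfl⟩))⟩
  rwa [hxy, Idx.other_other]

theorem Inv.start (Φ : Idx → Cnf V) (c : Config V) (hc : start Φ = .run c) : Inv Φ c := by
  have hc' := State.run.inj hc
  subst hc'
  refine .of_no_conflict ⟨fun _ => trivial, ?_, fun _ _ => rfl, ?_, ?_, ?_, ?_, ?_, ?_, ?_⟩ ?_
    (fun _ => rfl) (.normal ⟨rfl, rfl⟩ ?_)
  · rintro x e ⟨⟩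
  · rintro x e ⟨⟩
  · rintro x e ⟨⟩
  · rintro x e ⟨⟩
  · intro x C hC l hl
    exact mem_vars.2 ⟨C, List.mem_toFinset.1 hC, l, hl, rfl⟩
  · exact fun x C hC => List.mem_toFinset.2 hC
  · intro x
    rw [actCls_of_asserted]
    · ext C
      cases x <;> simp
    · intro p hp
      simp only [List.mem_append, List.mem_map] at hp
      rcases hp with ⟨C, -, rfl⟩ | ⟨C, -, rfl⟩
      exacts [⟨_, _, rfl⟩, ⟨_, _, rfl⟩]
  · refine ⟨fun k x C hk => ?_, fun k a b C hk => ?_, fun x C hC => ?_⟩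
    · simpa using List.mem_of_getElem? hk
    · simpa using List.mem_of_getElem? hk
    · cases x <;> simpa using hC
  · intro k hk hk'
    exact absurd (hk.trans hk') (by simp)
  · rintro e ⟨⟩

end Invariant

/-! ### Preservation of the invariant and validity of the final log -/

section Preservation

variable {V : Type*} [DecidableEq V] {Φ : Idx → Cnf V} {c c' : Config V}

theorem Inv.conflict_unique (h : Inv Φ c) {x y : Idx} {C D : Clause V}
    (hx : (c.sol x).conflict = some C) (hy : (c.sol y).conflict = some D) : y = x := by
  by_contra hne
  have := (h.conflict x C hx).2.2
  rw [← Idx.eq_other_of_ne hne, hy] at this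
  cases this

/-- The modes are kept by changes of the conflict and of reasons in a module with a conflict. -/
theorem Inv.modes_of_conflict (h : Inv Φ c) {x : Idx} {C : Clause V}
    (hC : (c.sol x).conflict = some C) (hmode : ∀ y, (c'.sol y).mode = (c.sol y).mode)
    (hlevel : c'.level = c.level)
    (ht : ∀ y, ∀ a ∈ (c'.sol y).trail, ∃ e ∈ (c.sol y).trail, a.level = e.level ∧
      (a.reason = .decision → e.reason = .decision))
    (hsol : ∀ y, y ≠ x → (c'.sol y).db ⊆ (c.sol y).db ∧ (c'.sol y).trail = (c.sol y).trail ∧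
      (c'.sol y).conflict = (c.sol y).conflict) : ModeInv Φ c' := by
  refine h.modes.congr hmode hlevel ht fun y hy hn => ?_
  obtain ⟨h1, h2, h3⟩ := hsol y (by rintro rfl; rw [hC] at hn; cases hn)
  exact ⟨hy.mono h1 fun e he => ⟨e, h2 ▸ he, rfl⟩, h3.trans hn⟩

/-- Unsatisfiability enters only through the two rules leading to ⟨F, F⟩, where both modules would
have full satisfying assignments. -/
theorem Inv.step (hunsat : ¬ ∃ τ : V → Bool, (Φ .s).SatBy τ ∧ (Φ .m).SatBy τ) (h : Inv Φ c)
    (ht : Trans Φ (.run c) (.run c')) : Inv Φ c' := by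
  cases ht with
  | propagate _ x C l hq hmode hC hu =>
    refine .of_no_conflict (h.core.assign (by simp) (h.core.db_vars x C hC l hu.1) hu.2.1 ?_
      (by simp)) (h.covered.mono le_rfl fun y e he _ =>
        ⟨e, mem_assign_trail.2 (Or.inl he), rfl⟩) hq.1 (h.modes.propagate h.core hmode hu.2.1)
    intro R hR
    rw [Reason.clause.injEq] at hR
    exact hR ▸ ⟨hC, hu.1, hu.2.2⟩
  | decide _ x l hq hmode hv hu =>
    exact .of_no_conflict (h.core.incLevel.assign (by simp) hv hu (by simp)
      fun _ => ⟨Nat.succ_pos _, fun a ha => Nat.lt_succ_of_le (h.core.level_le x a ha)⟩)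
      (h.covered.incLevel_assign _ _ _ _) hq.1 (h.modes.decide h.core hmode hu)
  | delete _ x C hq hC hin hlock =>
    refine .of_no_conflict (h.core.delete hin hlock) h.covered hq.1
      (h.modes.congr (fun _ => rfl) rfl (fun y a ha => ⟨a, ha, rfl, id⟩) fun y hy hn =>
        ⟨hy.mono ?_ fun e he => ⟨e, he, rfl⟩, hn⟩)
    change (if y = x then (c.sol y).db.erase C else (c.sol y).db) ⊆ (c.sol y).db
    split_ifs
    exacts [Finset.erase_subset _ _, subset_rfl]
  | conflict _ x C hq hC hf =>
    refine ⟨h.core.setConflict _ _, h.covered, fun y D hD => ?_,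
      h.modes.congr (fun _ => rfl) rfl (fun y a ha => ⟨a, ha, rfl, id⟩) fun y hy hn =>
        ⟨hy, ?_⟩⟩
    · change (if y = x then some C else (c.sol y).conflict) = some D at hD
      split_ifs at hD with hy
      · cases hD
        subst hy
        refine ⟨hf, .of_mem hC, ?_⟩
        change (if y.other = y then some C else (c.sol y.other).conflict) = none
        rw [if_neg (Idx.other_ne y), hq.1]
      · rw [hq.1] at hD
        cases hD
    -- A module with a full satisfying assignment falsifies none of its clauses, so the new conflict
    -- is not there.
    · change (if y = x then some C else (c.sol y).conflict) = none
      rw [if_neg, hn]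
      rintro rfl
      exact hy.not_falsified h.core hC hf
  | explain _ x C R e hC he hl hr =>
    obtain ⟨hf, hR, ho⟩ := h.conflict x C hC
    refine ⟨h.core.setConflict _ _, h.covered, fun y D hD => ?_,
      h.modes_of_conflict hC (fun _ => rfl) rfl (fun y a ha => ⟨a, ha, rfl, id⟩)
        fun y hy => ⟨subset_rfl, rfl, if_neg hy⟩⟩
    change (if y = x then some _ else (c.sol y).conflict) = some D at hD
    split_ifs at hD with hy
    · cases hD
      subst hy
      refine ⟨hf.resolve (h.core.wf y) he hr, hR.resolve (h.core.reason_mem y e he R hr) _, ?_⟩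
      change (if y.other = y then some _ else (c.sol y.other).conflict) = none
      rw [if_neg (Idx.other_ne y), ho]
    · exact absurd (h.conflict_unique hC hD) hy
  | getReason _ x C R e hC he hl hr hR =>
    have hsh := (hR.spec (h.core.wf _)).1
    refine ⟨(h.core.copyTo hsh (hR.rup fun a ha R' hR' => h.core.reason_mem _ a ha R' hR')
      ).setReason (mem_copyTo_db.2 (Or.inr ⟨rfl, rfl⟩)) (by simpa using hR), ?_, ?_, ?_⟩
    · refine h.covered.mono (copyTo_level c x R).le fun y a ha _ => ?_
      obtain ⟨a', h1, -, h2, -⟩ := exists_mem_setReason_trail (c := c.copyTo x R) (x := x)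
        (l := e.lit) (R := R) (y := y) (e := a) (by simpa using ha)
      exact ⟨a', h1, h2⟩
    · intro y D hD
      have hD' : (c.sol y).conflict = some D := (copyTo_conflict c x R y).symm.trans hD
      obtain ⟨h1, h2, h3⟩ := h.conflict y D hD'
      refine ⟨fun k hk => ?_, h2.mono fun E hE => mem_copyTo_db.2 (Or.inl hE),
        (copyTo_conflict c x R y.other).trans h3⟩
      exact onTrail_setReason.2 (by simpa using h1 k hk)
    · refine h.modes_of_conflict hC (fun y => copyTo_mode c x R y) (copyTo_level c x R)
        (fun y a ha => ?_) fun y hy => ⟨fun D hD => ?_, ?_, copyTo_conflict c x R y⟩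
      · obtain ⟨b, hb, -, h2, h3⟩ := mem_setReason_trail ha
        refine ⟨b, by simpa using hb, h2, fun hd => ?_⟩
        rcases h3 with h3 | ⟨-, -, h3⟩ <;> rw [h3] at hd
        · exact hd
        · cases hd
      · rcases mem_copyTo_db.1 hD with h | ⟨h, -⟩
        exacts [h, absurd h hy]
      · rw [setReason_trail, if_neg hy, copyTo_trail]
  | handOver _ C hmode hC hI =>
    obtain ⟨h1, h2, h3⟩ := h.transfer (y := .m) rfl hC hI
    refine ⟨h1, h.covered.mono (copyTo_level c .m C).le fun y a ha _ =>
      ⟨a, by simpa [Config.setConflict] using ha, rfl⟩, fun y D hD => ?_, ?_⟩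
    · cases y with
      | s => cases hD
      | m =>
        cases hD
        exact ⟨by simpa [Config.setConflict] using h2, h3, rfl⟩
    · have hm := h.modes
      cases hm with
      | normal hn hdec =>
        exact .normal ⟨(copyTo_mode c .m C .s).trans hn.1, (copyTo_mode c .m C .m).trans hn.2⟩
          fun a ha => hdec a (by simpa [Config.setConflict] using ha)
      | exploring i hs => rw [hs] at hmode; cases hmode
      | speculating i hs => rw [hs] at hmode; cases hmode
      | validating i j hs => rw [hs] at hmode; cases hmode
  | backjump _ C e b hmode hC ha =>
    obtain ⟨h1, h2, h3⟩ := h.backjump hC ha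
    refine .of_no_conflict h1 h2 h3 (.normal (by simpa [Config.Normal] using hmode)
      fun a ha' hd => ?_)
    have hm := h.modes
    cases hm with
    | normal hn hdec => exact hdec a (decision_of_mem_backjump ha' hd).1 hd
    | exploring i hs => rw [hmode.1] at hs; cases hs
    | speculating i hs => rw [hmode.1] at hs; cases hs
    | validating i j hs => rw [hmode.1] at hs; cases hs
  | mainSat _ hq hmode hsat =>
    have hm := h.modes
    refine .of_no_conflict (h.core.setModes _ _) h.covered hq.1 ?_
    cases hm with
    | normal hn hdec =>
      exact .exploring c.level rfl rfl le_rfl (fun a ha hd => absurd hd (hdec a ha))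
        (h.core.level_le .m) hsat (hq.1 .m)
    | exploring i hs => rw [hmode.1] at hs; cases hs
    | speculating i hs => rw [hmode.1] at hs; cases hs
    | validating i j hs => rw [hmode.1] at hs; cases hs
  | speculate _ hq hmode hunit =>
    have hm := h.modes
    refine .of_no_conflict (h.core.setModes _ _) h.covered hq.1 ?_
    cases hm with
    | normal hn hdec =>
      exact .speculating c.level rfl rfl le_rfl (fun a ha hd => absurd hd (hdec a ha))
        (fun a ha _ => h.core.level_le .m a ha)
    | exploring i hs => rw [hmode.1] at hs; cases hs
    | speculating i hs => rw [hmode.1] at hs; cases hs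
    | validating i j hs => rw [hmode.1] at hs; cases hs
  | secBackjump _ C e i b hmode hC ha hb =>
    obtain ⟨h1, h2, h3⟩ := h.backjump hC ha
    refine .of_no_conflict h1 h2 h3 ?_
    have hm := h.modes
    cases hm with
    | normal hn hdec => rw [hn.1] at hmode; cases hmode
    | exploring i' hs hm hi hdec hlev hsat hconf =>
      obtain rfl : i' = i := by rw [hs] at hmode; cases hmode; rfl
      obtain ⟨g1, g2⟩ := hsat.backjump h.core (by decide) hlev hb ha
      exact .exploring i' (by simpa using hs) (by simpa using hm) hb
        (fun a ha' hd => hdec a (decision_of_mem_backjump ha' hd).1 hd) g2 g1 (h3 _)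
    | speculating i' hs hm hi hdec hdec' =>
      obtain rfl : i' = i := by rw [hs] at hmode; cases hmode; rfl
      exact .speculating i' (by simpa using hs) (by simpa using hm) hb
        (fun a ha' hd => hdec a (decision_of_mem_backjump ha' hd).1 hd)
        (fun a ha' hd => hdec' a (decision_of_mem_backjump ha' hd).1 hd)
    | validating i j hs => rw [hs] at hmode; cases hmode
  | secBlocked _ C i hmode hC hI hlev =>
    obtain ⟨h1, h2, h3⟩ := h.transfer (y := .m) rfl hC hI
    obtain ⟨hi, hdec⟩ := h.modes.decision_lt hmode
    refine Inv.blocked h1 (h.covered.mono (copyTo_level c .m C).le fun y a ha _ =>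
      ⟨a, by simpa [Config.setConflict] using ha, rfl⟩)
      (hi.trans (copyTo_level c .m C).ge) (fun a ha =>
        hdec a (by simpa [Config.setConflict] using ha)) rfl rfl
      (by simpa [Config.setConflict] using h2) h3 ?_
    -- The literals of the shared clause `C` have equal levels on both trails, so the bound found in
    -- `s` holds in `m`.
    intro a ha haC
    obtain ⟨a', ha', hl, hl'⟩ := h.core.exists_shared (x := .m) .s (e := a)
      (by simpa [Config.setConflict] using ha) (hI (neg a.lit) haC)
    exact hl' ▸ hlev a' ha' (hl ▸ haC)
  | mainToSec _ C i hs hm hC hI =>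
    obtain ⟨h1, h2, h3⟩ := h.transfer (y := .s) rfl hC hI
    refine ⟨h1, h.covered.mono (copyTo_level c .s C).le fun y a ha _ =>
      ⟨a, by simpa [Config.setConflict] using ha, rfl⟩, fun y D hD => ?_, ?_⟩
    · cases y with
      | m => cases hD
      | s =>
        cases hD
        exact ⟨by simpa [Config.setConflict] using h2, h3, rfl⟩
    · have hmo := h.modes
      cases hmo with
      | normal hn hdec => rw [hn.1] at hs; cases hs
      | exploring i' hs' hm' => rw [hm] at hm'; cases hm'
      | speculating i' hs' hm' hi hdec hdec' =>
        exact .speculating i' ((copyTo_mode c .s C .s).trans hs')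
          ((copyTo_mode c .s C .m).trans hm') (hi.trans (copyTo_level c .s C).ge)
          (fun a ha => hdec a (by simpa [Config.setConflict] using ha))
          (fun a ha => hdec' a (by simpa [Config.setConflict] using ha))
      | validating i j hs' => rw [hs] at hs'; cases hs'
  | mainBlocked _ C i hs hm hC hlev =>
    obtain ⟨hi, hdec⟩ := h.modes.decision_lt hs
    obtain ⟨h1, h2, h3⟩ := h.conflict _ _ hC
    exact Inv.blocked h.core h.covered hi hdec h3 hC h1 h2 hlev
  | secRefine _ C e i l hmode hC he hl hr hlev hR hvar =>
    obtain ⟨a, ha, hal, hal'⟩ := h.core.exists_shared .m he (h.core.ext .s e he hr).1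
    exact h.refine ha (hvar.trans (by rw [hal])) (hal' ▸ hlev) (h.modes.decision_lt hmode).2
  | mainRefine _ C d e i l hs hm hC hd hdC hdr hdI he heI hlev hvar =>
    obtain ⟨a, ha, hal, hal'⟩ := h.core.exists_shared .m he heI
    exact h.refine ha (hvar.trans (by rw [hal])) (hal' ▸ hlev) (h.modes.decision_lt hs).2
  | validate _ i hq hs hm hsat =>
    have hmo := h.modes
    refine .of_no_conflict (h.core.setModes _ _) h.covered hq.1 ?_
    cases hmo with
    | normal hn hdec => rw [hn.1] at hs; cases hs
    | exploring i' hs' hm' => rw [hm] at hm'; cases hm'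
    | speculating i' hs' hm' hi hdec hdec' =>
      obtain rfl : i' = i := by rw [hs] at hs'; cases hs'; rfl
      exact .validating i' c.level rfl rfl hi le_rfl hdec
        (fun a ha hd => Or.inl (hdec' a ha hd)) (h.core.level_le .s) hsat (hq.1 .s)
    | validating i j hs' => rw [hs] at hs'; cases hs'
  | secSat _ i hq hs hm hsat =>
    have hmo := h.modes
    cases hmo with
    | normal hn hdec => rw [hn.1] at hs; cases hs
    | exploring i' hs' hm' hi hdec hlev hsat' =>
      exact absurd (FullSat.satBy h.core (by rintro (_ | _) <;> assumption)) hunsat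
    | speculating i' hs' hm' => rw [hm] at hm'; cases hm'
    | validating i j hs' => rw [hs] at hs'; cases hs'
  | validated _ i j hq hs hm hsat =>
    have hmo := h.modes
    cases hmo with
    | normal hn hdec => rw [hn.1] at hs; cases hs
    | exploring i' hs' hm' => rw [hm] at hm'; cases hm'
    | speculating i' hs' hm' => rw [hm] at hm'; cases hm'
    | validating i j hs' hm' hi hj hdec hdec' hlev hsat' =>
      exact absurd (FullSat.satBy h.core (by rintro (_ | _) <;> assumption)) hunsat
  | valBackjump _ C e i j b hs hm hC ha hb =>
    obtain ⟨h1, h2, h3⟩ := h.backjump hC ha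
    refine .of_no_conflict h1 h2 h3 ?_
    have hmo := h.modes
    cases hmo with
    | normal hn hdec => rw [hn.1] at hs; cases hs
    | exploring i' hs' hm' => rw [hm] at hm'; cases hm'
    | speculating i' hs' hm' => rw [hm] at hm'; cases hm'
    | validating i' j' hs' hm' hi hj hdec hdec' hlev hsat hconf =>
      obtain ⟨rfl, rfl⟩ : i' = i ∧ j' = j := by rw [hm] at hm'; cases hm'; exact ⟨rfl, rfl⟩
      obtain ⟨g1, g2⟩ := hsat.backjump h.core (by decide) hlev hb ha
      exact .validating i' j' (by simpa using hs) (by simpa using hm) hi hb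
        (fun a ha' hd => hdec a (decision_of_mem_backjump ha' hd).1 hd)
        (fun a ha' hd => hdec' a (decision_of_mem_backjump ha' hd).1 hd) g2 g1 (h3 _)
  | valExit _ C e i j b hs hm hC ha hb =>
    obtain ⟨h1, h2, h3⟩ := h.backjump hC ha
    refine .of_no_conflict (h1.setModes _ _) h2 h3 (.normal ⟨rfl, rfl⟩ fun a ha' hd => ?_)
    obtain ⟨ha', hal⟩ := decision_of_mem_backjump
      (show a ∈ ((c.backjump (interface Φ) .m C (neg e.lit) b).sol .s).trail from ha') hd
    have hmo := h.modes
    cases hmo with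
    | normal hn hdec => rw [hn.1] at hs; cases hs
    | exploring i' hs' hm' => rw [hm] at hm'; cases hm'
    | speculating i' hs' hm' => rw [hm] at hm'; cases hm'
    | validating i' j' hs' hm' hi hj hdec hdec' hlev hsat hconf =>
      obtain ⟨rfl, rfl⟩ : i' = i ∧ j' = j := by rw [hm] at hm'; cases hm'; exact ⟨rfl, rfl⟩
      -- Decisions of `s` lie above `i`, but this one survived a backjump to `b < i`.
      have := hdec a ha' hd
      omega
  | valRefine _ C e i j l hs hm hC he hl hr hlev hR hvar =>
    have hmo := h.modes
    cases hmo with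
    | normal hn hdec => rw [hn.1] at hs; cases hs
    | exploring i' hs' hm' => rw [hm] at hm'; cases hm'
    | speculating i' hs' hm' => rw [hm] at hm'; cases hm'
    | validating i' j' hs' hm' hi hj hdec hdec' hlev hsat hconf =>
      obtain ⟨rfl, rfl⟩ : i' = i ∧ j' = j := by rw [hm] at hm'; cases hm'; exact ⟨rfl, rfl⟩
      exact h.refine he hvar ‹_› hdec

/-- The conflict ⊥ is RUP for the database of `m`, which is exactly the set against which the final
step is checked. -/
theorem Inv.unsat_log (h : Inv Φ c) {π : List (ProofStep V)}
    (ht : Trans Φ (.run c) (.unsat π)) : IsModularDRUPProofOf π Φ := by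
  cases ht with
  | fail _ hC =>
    have hlog : LogOK Φ (c.log ++ [.rup .m ∅]) := h.core.log_ok.append (by
      change RUP (actCls c.log .m) ∅
      rw [h.core.act]
      exact (h.conflict _ _ hC).2.1)
    exact ⟨⟨hlog.rup_ok, hlog.cp_ok, Or.inl (by simp)⟩, hlog.asserted⟩

end Preservation

/-! ### The termination measure -/

section Rank

variable {V : Type*} [DecidableEq V] {Φ : Idx → Cnf V} {c c' : Config V}

/-- The number of variables of both modules. -/
def inputSize (Φ : Idx → Cnf V) : ℕ := (vars (Φ .s)).card + (vars (Φ .m)).card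

/-- The weight of both trails up to level `b`. -/
def weight (Φ : Idx → Cnf V) (c : Config V) (b : ℕ) : ℕ :=
  trailWeight (inputSize Φ) b (c.sol .s).trail + trailWeight (inputSize Φ) b (c.sol .m).trail

/-- An upper bound on weights. -/
def maxWeight (Φ : Idx → Cnf V) : ℕ := inputSize Φ * (inputSize Φ + 1) ^ inputSize Φ

theorem Core.length_trail_le (h : Core Φ c) (x : Idx) :
    (c.sol x).trail.length ≤ (vars (Φ x)).card := by
  have := List.toFinset_card_of_nodup (h.wf x).nodup_vars
  rw [List.length_map] at this
  rw [← this]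
  refine Finset.card_le_card fun v hv => ?_
  obtain ⟨e, he, rfl⟩ := List.mem_map.1 (List.mem_toFinset.1 hv)
  exact h.trail_vars x e he

theorem Core.weight_le (h : Core Φ c) (b : ℕ) : weight Φ c b ≤ maxWeight Φ := by
  refine (Nat.add_le_add (trailWeight_le _ _ _) (trailWeight_le _ _ _)).trans ?_
  rw [← add_mul]
  exact Nat.mul_le_mul_right _ (Nat.add_le_add (h.length_trail_le .s) (h.length_trail_le .m))

/-- By `Covered` every positive level carries an entry, and the two trails have at most `inputSize
Φ` entries. This keeps the truncated exponents of `trailWeight` exact at the levels in use. -/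
theorem Core.level_le_inputSize (h : Core Φ c) (hcov : Covered c) : c.level ≤ inputSize Φ := by
  have hsub : Finset.Icc 1 c.level ⊆ ((c.sol .s).trail.map Entry.level).toFinset ∪
      ((c.sol .m).trail.map Entry.level).toFinset := by
    intro k hk
    obtain ⟨hk1, hk2⟩ := Finset.mem_Icc.1 hk
    obtain ⟨x, e, he, rfl⟩ := hcov k hk1 hk2
    rw [Finset.mem_union, List.mem_toFinset, List.mem_toFinset]
    cases x
    exacts [Or.inl (List.mem_map_of_mem he), Or.inr (List.mem_map_of_mem he)]
  have h1 := (Finset.card_le_card hsub).trans (Finset.card_union_le _ _)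
  have h2 := fun x => (List.toFinset_card_le ((c.sol x).trail.map Entry.level)).trans
    ((List.length_map (as := (c.sol x).trail) Entry.level).le.trans (h.length_trail_le x))
  rw [Nat.card_Icc] at h1
  have := h2 .s
  have := h2 .m
  unfold inputSize
  omega

theorem weight_mono {b b' : ℕ} (h : b ≤ b') : weight Φ c b ≤ weight Φ c b' :=
  Nat.add_le_add (trailWeight_mono _ h _) (trailWeight_mono _ h _)

theorem weight_congr (h : ∀ y, (c'.sol y).trail = (c.sol y).trail) (b : ℕ) :
    weight Φ c' b = weight Φ c b := by
  rw [weight, h, h]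
  rfl

theorem weight_backTo {b b' : ℕ} (h : b ≤ b') : weight Φ (c.backTo b') b = weight Φ c b :=
  congrArg₂ (· + ·) (trailWeight_filter _ _ h) (trailWeight_filter _ _ h)

theorem weight_setModes (a a' : Mode) (b : ℕ) :
    weight Φ (c.setModes a a') b = weight Φ c b := rfl

theorem weight_le_assign (I : Finset V) (x : Idx) (l : Lit V) (r : Reason V) (b : ℕ) :
    weight Φ c b ≤ weight Φ (c.assign I x l r) b := by
  have key : ∀ y, trailWeight (inputSize Φ) b (c.sol y).trail ≤
      trailWeight (inputSize Φ) b ((c.assign I x l r).sol y).trail := by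
    intro y
    rw [assign_trail]
    split_ifs <;> simp [trailWeight_cons]
  exact Nat.add_le_add (key .s) (key .m)

theorem weight_assign_ge (I : Finset V) (x : Idx) (l : Lit V) (r : Reason V) {b : ℕ}
    (hb : c.level ≤ b) :
    weight Φ c b + (inputSize Φ + 1) ^ (inputSize Φ - c.level) ≤
      weight Φ (c.assign I x l r) b := by
  have key : ∀ y, trailWeight (inputSize Φ) b (c.sol y).trail +
      (if y = x then (inputSize Φ + 1) ^ (inputSize Φ - c.level) else 0) ≤
      trailWeight (inputSize Φ) b ((c.assign I x l r).sol y).trail := by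
    intro y
    rw [assign_trail]
    split_ifs <;> simp [trailWeight_cons, hb, add_comm]
  have h1 := key .s
  have h2 := key .m
  unfold weight
  cases x <;> simp only [if_true, reduceCtorEq, if_false] at h1 h2 <;> omega

theorem weight_lt_assign (I : Finset V) (x : Idx) (l : Lit V) (r : Reason V) {b : ℕ}
    (hb : c.level ≤ b) : weight Φ c b < weight Φ (c.assign I x l r) b := by
  have := weight_assign_ge (Φ := Φ) I x l r hb
  have : 0 < (inputSize Φ + 1) ^ (inputSize Φ - c.level) := by positivity
  omega

/-- Backjumping increases the weight of the trails. -/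
theorem Core.weight_lt_backjump (h : Core Φ c) (hcov : Covered c) (x : Idx) (C : Clause V)
    (l : Lit V) {b b' n : ℕ} (hb : b < c.level) (hb' : b ≤ b') :
    weight Φ c n < weight Φ (c.backjump (interface Φ) x C l b) b' := by
  have h1 := weight_assign_ge (Φ := Φ) (c := (((c.setConflict x none).learn x C).backTo b))
    (interface Φ) x l (.clause C) (b := b) le_rfl
  rw [weight_backTo le_rfl, weight_congr (c := c) fun y => by simp [Config.setConflict]] at h1
  have h2 : weight Φ (c.backjump (interface Φ) x C l b) b ≤
    weight Φ (c.backjump (interface Φ) x C l b) b' := weight_mono hb'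
  -- At most `inputSize Φ` entries lie above `b`, and an entry of level `b` outweighs each of them
  -- by a factor of at least `inputSize Φ + 1`. The new literal thus outweighs everything lost.
  have h3 : weight Φ c n ≤ weight Φ c b +
      inputSize Φ * (inputSize Φ + 1) ^ (inputSize Φ - (b + 1)) := by
    have hs := trailWeight_le_add (inputSize Φ) b n (c.sol .s).trail
    have hm := trailWeight_le_add (inputSize Φ) b n (c.sol .m).trail
    have := Nat.mul_le_mul_right ((inputSize Φ + 1) ^ (inputSize Φ - (b + 1)))
      (Nat.add_le_add (h.length_trail_le .s) (h.length_trail_le .m))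
    rw [add_mul] at this
    unfold weight
    change _ ≤ _ + ((vars (Φ .s)).card + (vars (Φ .m)).card) * _
    omega
  have h4 : (inputSize Φ + 1) ^ (inputSize Φ - b) =
      (inputSize Φ + 1) ^ (inputSize Φ - (b + 1)) * (inputSize Φ + 1) := by
    rw [← pow_succ]
    congr 1
    have := h.level_le_inputSize hcov
    omega
  have h5 : 0 < (inputSize Φ + 1) ^ (inputSize Φ - (b + 1)) := by positivity
  change _ + (inputSize Φ + 1) ^ (inputSize Φ - b) ≤ weight Φ (c.backjump _ _ _ _ _) b at h1
  rw [h4, mul_add, mul_one, mul_comm] at h1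
  exact (h3.trans_lt (by omega)).trans_le (h1.trans h2)

/-- If `n < b`, no entry up to level `n` is removed; otherwise the asserted literal compensates for
the loss. -/
theorem Core.weight_le_backjump (h : Core Φ c) (hcov : Covered c) (x : Idx) (C : Clause V)
    (l : Lit V) {b : ℕ} (hb : b < c.level) (n : ℕ) :
    weight Φ c n ≤ weight Φ (c.backjump (interface Φ) x C l b) n := by
  rcases le_or_gt b n with hn | hn
  · exact (h.weight_lt_backjump hcov x C l hb hn).le
  · have := weight_le_assign (Φ := Φ) (c := (((c.setConflict x none).learn x C).backTo b))
      (interface Φ) x l (.clause C) n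
    rwa [weight_backTo hn.le, weight_congr (c := c) fun y => by simp [Config.setConflict]] at this

/-- The cut-offs `i` and `i + 1` are the base levels before and after refinement: the trail up to
`i` is kept and gains the new decision. -/
theorem weight_lt_refine (i : ℕ) (l : Lit V) :
    weight Φ c i < weight Φ (c.refine (interface Φ) i l) (i + 1) := by
  refine lt_of_le_of_lt ?_ (weight_lt_assign (Φ := Φ) (interface Φ) .m l .decision le_rfl)
  exact (weight_backTo (Φ := Φ) (c := c) le_rfl).ge.trans (weight_mono (Nat.le_succ i))

/-- The number of literals without a reason in their module. -/
def numExt (t : List (Entry V)) : ℕ :=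
  t.countP fun e => match e.reason with | .ext => true | _ => false

theorem weight_setReason (x : Idx) (l : Lit V) (R : Clause V) (b : ℕ) :
    weight Φ (c.setReason x l R) b = weight Φ c b := by
  have key : ∀ y, trailWeight (inputSize Φ) b ((c.setReason x l R).sol y).trail =
      trailWeight (inputSize Φ) b (c.sol y).trail := by
    intro y
    rw [setReason_trail]
    split_ifs
    · generalize (c.sol y).trail = t
      induction t with
      | nil => rfl
      | cons e t ih =>
        rw [List.map_cons, trailWeight_cons, trailWeight_cons, ih]
        split_ifs <;> rfl
    · rfl
  exact congrArg₂ (· + ·) (key .s) (key .m)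

omit [DecidableEq V] in
theorem numExt_cons (e : Entry V) (t : List (Entry V)) : numExt (e :: t) =
    numExt t + match e.reason with | .ext => 1 | _ => 0 := by
  unfold numExt
  rw [List.countP_cons]
  cases e.reason <;> rfl

theorem numExt_map_setReason (t : List (Entry V)) (l : Lit V) (R : Clause V) :
    numExt (t.map fun e => if e.lit = l then { e with reason := .clause R } else e) ≤ numExt t ∧
    ∀ e ∈ t, e.lit = l → e.reason = .ext →
      numExt (t.map fun e => if e.lit = l then { e with reason := .clause R } else e) <
        numExt t := by
  induction t with
  | nil => simp
  | cons a t ih =>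
    rw [List.map_cons, numExt_cons, numExt_cons]
    constructor
    · split_ifs
      · exact ih.1.trans (Nat.le_add_right _ _)
      · exact Nat.add_le_add_right ih.1 _
    · intro e he hl hr
      rcases List.mem_cons.1 he with rfl | he
      · rw [if_pos hl, hr]
        exact Nat.lt_succ_of_le ih.1
      · have := ih.2 e he hl hr
        split_ifs
        · exact this.trans_le (Nat.le_add_right _ _)
        · exact Nat.add_lt_add_right this _

theorem numExt_setReason_lt {x : Idx} {e : Entry V} (R : Clause V) (he : e ∈ (c.sol x).trail)
    (hr : e.reason = .ext) :
    numExt ((c.setReason x e.lit R).sol .s).trail + numExt ((c.setReason x e.lit R).sol .m).trail <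
      numExt (c.sol .s).trail + numExt (c.sol .m).trail := by
  rw [setReason_trail, setReason_trail]
  have := (numExt_map_setReason (c.sol x).trail e.lit R).2 e he rfl hr
  cases x
  · exact Nat.add_lt_add_right this _
  · exact Nat.add_lt_add_left this _

/-- The level up to which the trails are kept by speculation. -/
def baseLevel (c : Config V) : ℕ :=
  match (c.sol .s).mode, (c.sol .m).mode with
  | .decide i, _ => i
  | .finished, .validate i _ => i
  | _, _ => c.level

/-- The stage of the search since the last change of the trails up to the base level. -/
def stage (c : Config V) : ℕ :=
  match (c.sol .s).mode with
  | .propagate =>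
    match (c.sol .s).conflict, (c.sol .m).conflict with
    | none, none => 3
    | _, _ => 0
  | .decide _ => 2
  | _ => 1

/-- The phase of conflict analysis: conflicts go from `s` to `m` in normal execution, and from
`m` to `s` in speculation. -/
def phase (c : Config V) : ℕ :=
  match (c.sol .s).conflict, (c.sol .m).conflict with
  | none, none => 2
  | none, some _ => match (c.sol .s).mode with | .propagate => 0 | _ => 1
  | some _, _ => match (c.sol .s).mode with | .propagate => 1 | _ => 0

def conflictWeight (s : Solver V) : ℕ :=
  match s.conflict with
  | none => 0
  | some C => clauseWeight C s.trail

/-- A lexicographic measure that decreases with every transition. -/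
def rank (Φ : Idx → Cnf V) (c : Config V) : ℕ ×ₗ ℕ ×ₗ ℕ ×ₗ ℕ ×ₗ ℕ ×ₗ ℕ ×ₗ ℕ :=
  toLex (maxWeight Φ - weight Φ c (baseLevel c), toLex (stage c,
    toLex (maxWeight Φ - weight Φ c c.level, toLex (phase c,
    toLex (numExt (c.sol .s).trail + numExt (c.sol .m).trail,
    toLex (conflictWeight (c.sol .s) + conflictWeight (c.sol .m),
      (c.sol .s).db.card + (c.sol .m).db.card))))))

theorem toLex_lt_of_lt {α β : Type*} [PartialOrder α] [Preorder β] {a a' : α} {b b' : β}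
    (h : a < a') : toLex (a, b) < toLex (a', b') :=
  Prod.Lex.toLex_lt_toLex.2 (Or.inl h)

theorem toLex_lt_of_le_of_lt {α β : Type*} [PartialOrder α] [Preorder β] {a a' : α} {b b' : β}
    (h : a ≤ a') (h' : b < b') : toLex (a, b) < toLex (a', b') := by
  rw [Prod.Lex.toLex_lt_toLex]
  rcases h.lt_or_eq with h | h
  exacts [Or.inl h, Or.inr ⟨h, h'⟩]

/-- `Core Φ c'` bounds the new weight by `maxWeight Φ`, so the truncated difference strictly
decreases. -/
theorem rank_lt_of_base (h : Core Φ c')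
    (hw : weight Φ c (baseLevel c) < weight Φ c' (baseLevel c')) : rank Φ c' < rank Φ c :=
  toLex_lt_of_lt (by have := h.weight_le (baseLevel c'); omega)

theorem rank_lt_of_stage (hw : weight Φ c (baseLevel c) ≤ weight Φ c' (baseLevel c'))
    (hs : stage c' < stage c) : rank Φ c' < rank Φ c :=
  toLex_lt_of_le_of_lt (by omega) (toLex_lt_of_lt hs)

theorem rank_lt_of_weight (h : Core Φ c')
    (hw : weight Φ c (baseLevel c) ≤ weight Φ c' (baseLevel c')) (hs : stage c' ≤ stage c)
    (hw' : weight Φ c c.level < weight Φ c' c'.level) : rank Φ c' < rank Φ c :=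
  toLex_lt_of_le_of_lt (by omega) (toLex_lt_of_le_of_lt hs
    (toLex_lt_of_lt (by have := h.weight_le c'.level; omega)))

theorem rank_lt_of_phase (hw : weight Φ c (baseLevel c) ≤ weight Φ c' (baseLevel c'))
    (hs : stage c' ≤ stage c) (hw' : weight Φ c c.level ≤ weight Φ c' c'.level)
    (hp : phase c' < phase c) : rank Φ c' < rank Φ c :=
  toLex_lt_of_le_of_lt (by omega) (toLex_lt_of_le_of_lt hs
    (toLex_lt_of_le_of_lt (by omega) (toLex_lt_of_lt hp)))

theorem rank_lt_of_numExt (hw : weight Φ c (baseLevel c) ≤ weight Φ c' (baseLevel c'))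
    (hs : stage c' ≤ stage c) (hw' : weight Φ c c.level ≤ weight Φ c' c'.level)
    (hp : phase c' ≤ phase c)
    (he : numExt (c'.sol .s).trail + numExt (c'.sol .m).trail <
      numExt (c.sol .s).trail + numExt (c.sol .m).trail) : rank Φ c' < rank Φ c :=
  toLex_lt_of_le_of_lt (by omega) (toLex_lt_of_le_of_lt hs
    (toLex_lt_of_le_of_lt (by omega) (toLex_lt_of_le_of_lt hp (toLex_lt_of_lt he))))

theorem rank_lt_of_trail_eq (ht : ∀ y, (c'.sol y).trail = (c.sol y).trail)
    (hb : baseLevel c' = baseLevel c) (hl : c'.level = c.level)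
    (hs : stage c' ≤ stage c) (hp : phase c' ≤ phase c)
    (h : toLex (conflictWeight (c'.sol .s) + conflictWeight (c'.sol .m),
        (c'.sol .s).db.card + (c'.sol .m).db.card) <
      toLex (conflictWeight (c.sol .s) + conflictWeight (c.sol .m),
        (c.sol .s).db.card + (c.sol .m).db.card)) : rank Φ c' < rank Φ c :=
  toLex_lt_of_le_of_lt (by rw [hb, weight_congr ht]) (toLex_lt_of_le_of_lt hs
    (toLex_lt_of_le_of_lt (by rw [hl, weight_congr ht]) (toLex_lt_of_le_of_lt hp
      (toLex_lt_of_le_of_lt (by rw [ht, ht]) h))))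

omit [DecidableEq V] in
theorem baseLevel_congr (h : ∀ y, (c'.sol y).mode = (c.sol y).mode) (hl : c'.level = c.level) :
    baseLevel c' = baseLevel c := by
  unfold baseLevel
  rw [h, h, hl]

omit [DecidableEq V] in
theorem baseLevel_of_decide {i : ℕ} (hs : (c.sol .s).mode = .decide i) : baseLevel c = i := by
  unfold baseLevel
  rw [hs]

omit [DecidableEq V] in
theorem baseLevel_of_normal (h : c.Normal) : baseLevel c = c.level := by
  unfold baseLevel
  rw [h.1]

omit [DecidableEq V] in
theorem baseLevel_of_validate {i j : ℕ} (hs : (c.sol .s).mode = .finished)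
    (hm : (c.sol .m).mode = .validate i j) : baseLevel c = i := by
  unfold baseLevel
  rw [hs, hm]

omit [DecidableEq V] in
theorem stage_congr (h : (c'.sol .s).mode = (c.sol .s).mode)
    (hc : ∀ y, (c'.sol y).conflict = none ↔ (c.sol y).conflict = none) : stage c' = stage c := by
  have h1 := hc .s
  have h2 := hc .m
  unfold stage
  rw [h]
  generalize (c.sol .s).conflict = o₁ at *
  generalize (c.sol .m).conflict = o₂ at *
  generalize (c'.sol .s).conflict = o₃ at *
  generalize (c'.sol .m).conflict = o₄ at *
  cases o₁ <;> cases o₂ <;> cases o₃ <;> cases o₄ <;> simp_all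

omit [DecidableEq V] in
theorem phase_congr (h : (c'.sol .s).mode = (c.sol .s).mode)
    (hc : ∀ y, (c'.sol y).conflict = none ↔ (c.sol y).conflict = none) : phase c' = phase c := by
  have h1 := hc .s
  have h2 := hc .m
  unfold phase
  rw [h]
  generalize (c.sol .s).conflict = o₁ at *
  generalize (c.sol .m).conflict = o₂ at *
  generalize (c'.sol .s).conflict = o₃ at *
  generalize (c'.sol .m).conflict = o₄ at *
  cases o₁ <;> cases o₂ <;> cases o₃ <;> cases o₄ <;> simp_all

omit [DecidableEq V] in
theorem stage_of_decide {i : ℕ} (hs : (c.sol .s).mode = .decide i) : stage c = 2 := by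
  unfold stage
  rw [hs]

omit [DecidableEq V] in
theorem stage_of_finished (hs : (c.sol .s).mode = .finished) : stage c = 1 := by
  unfold stage
  rw [hs]

omit [DecidableEq V] in
theorem stage_of_quiet (hn : (c.sol .s).mode = .propagate)
    (hq : ∀ y, (c.sol y).conflict = none) : stage c = 3 := by
  unfold stage
  rw [hn, hq, hq]

omit [DecidableEq V] in
theorem stage_of_conflict {x : Idx} {C : Clause V} (hn : (c.sol .s).mode = .propagate)
    (hC : (c.sol x).conflict = some C) : stage c = 0 := by
  unfold stage
  rw [hn]
  cases x <;> rw [hC]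
  cases (c.sol .s).conflict <;> rfl

omit [DecidableEq V] in
theorem phase_of_quiet (hq : ∀ y, (c.sol y).conflict = none) : phase c = 2 := by
  unfold phase
  rw [hq, hq]

omit [DecidableEq V] in
theorem phase_lt_of_conflict {x : Idx} {C : Clause V} (hC : (c.sol x).conflict = some C) :
    phase c < 2 := by
  unfold phase
  cases x <;> rw [hC]
  · cases (c.sol .s).mode <;> simp
  · cases (c.sol .s).conflict <;> cases (c.sol .s).mode <;> simp

omit [DecidableEq V] in
-- Conflicts affect the stage only when `s` is in mode `P`, where the conflict-free stage is the
-- highest.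
theorem stage_le_of_quiet (hm : (c'.sol .s).mode = (c.sol .s).mode)
    (hq : ∀ y, (c.sol y).conflict = none) : stage c' ≤ stage c := by
  unfold stage
  rw [hm, hq, hq]
  cases (c.sol .s).mode <;> simp only [le_refl]
  split <;> simp

omit [DecidableEq V] in
theorem phase_of_sec {C : Clause V} (hC : (c.sol .s).conflict = some C) :
    phase c = match (c.sol .s).mode with | .propagate => 1 | _ => 0 := by
  unfold phase
  rw [hC]

omit [DecidableEq V] in
theorem phase_of_main {C : Clause V} (hs : (c.sol .s).conflict = none)
    (hC : (c.sol .m).conflict = some C) :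
    phase c = match (c.sol .s).mode with | .propagate => 0 | _ => 1 := by
  unfold phase
  rw [hs, hC]

theorem ModeInv.not_finished (h : ModeInv Φ c) (hs : (c.sol .s).mode = .finished)
    (hm : (c.sol .m).mode = .finished) : False := by
  cases h with
  | normal hn => rw [hn.1] at hs; cases hs
  | exploring i hs' => rw [hs'] at hs; cases hs
  | speculating i hs' => rw [hs'] at hs; cases hs
  | validating i j _ hm' => rw [hm'] at hm; cases hm

theorem Core.lt_level (h : Core Φ c) {x : Idx} {C : Clause V} {e : Entry V} {b : ℕ}
    (ha : Asserting (c.sol x).trail C e b) : b < c.level :=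
  ha.2.2.1.trans_le (h.level_le x e ha.1)

/-- The first component to change is the base weight for normal backjumps, `valExit` and
refinements; the stage for the start of exploration, speculation or validation and for blocked
conflicts. Propagations, decisions and other backjumps change at the latest the full weight; new
conflicts and transfers, at the latest the phase. Below these, Reason lowers `numExt`, Explain the
conflict weight, and deletion the database size. -/
theorem Inv.rank_lt (h : Inv Φ c) (h' : Inv Φ c') (ht : Trans Φ (.run c) (.run c')) :
    rank Φ c' < rank Φ c := by
  have hc' := h'.core
  cases ht with
  | propagate _ x C l hq hmode hC hu =>
    exact rank_lt_of_weight hc' (weight_le_assign _ _ _ _ _)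
      (stage_congr rfl fun _ => Iff.rfl).le (weight_lt_assign _ _ _ _ le_rfl)
  | decide _ x l hq hmode hv hu =>
    have hlt := (weight_mono (Φ := Φ) (c := c) (Nat.le_succ c.level)).trans_lt
      (weight_lt_assign (Φ := Φ) (c := c.incLevel) (interface Φ) x l .decision le_rfl)
    refine rank_lt_of_weight hc' ?_ (stage_congr rfl fun _ => Iff.rfl).le hlt
    -- The base level follows the current level only in normal execution; elsewhere it is fixed, and
    -- a new entry cannot lower the weight up to it.
    have hm := h.modes
    cases hm with
    | normal hn _ =>
      rw [baseLevel_of_normal hn,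
        baseLevel_of_normal (c := c.incLevel.assign (interface Φ) x l .decision) hn]
      exact hlt.le
    | exploring i hs =>
      rw [baseLevel_of_decide hs, baseLevel_of_decide (i := i) (by exact hs)]
      exact weight_le_assign (c := c.incLevel) _ _ _ _ _
    | speculating i hs =>
      rw [baseLevel_of_decide hs, baseLevel_of_decide (i := i) (by exact hs)]
      exact weight_le_assign (c := c.incLevel) _ _ _ _ _
    | validating i j hs hm =>
      rw [baseLevel_of_validate hs hm,
        baseLevel_of_validate (i := i) (j := j) (by exact hs) (by exact hm)]
      exact weight_le_assign (c := c.incLevel) _ _ _ _ _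
  | delete _ x C hq hC hin hlock =>
    refine rank_lt_of_trail_eq (fun _ => rfl) (baseLevel_congr (fun _ => rfl) rfl) rfl
      (stage_congr rfl fun _ => Iff.rfl).le (phase_congr rfl fun _ => Iff.rfl).le
      (toLex_lt_of_le_of_lt le_rfl ?_)
    have := Finset.card_erase_lt_of_mem hC
    cases x
    · exact Nat.add_lt_add_right this _
    · exact Nat.add_lt_add_left this _
  | conflict _ x C hq hC hf =>
    refine rank_lt_of_phase le_rfl (stage_le_of_quiet rfl hq.1) le_rfl ?_
    rw [phase_of_quiet hq.1]
    exact phase_lt_of_conflict (x := x) (C := C) (if_pos rfl)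
  | explain _ x C R e hC he hl hr =>
    have hiff : ∀ y, ((c.setConflict x (some (resolve C e.lit R))).sol y).conflict = none ↔
        (c.sol y).conflict = none := by
      intro y
      change (if y = x then some _ else _) = none ↔ _
      split_ifs with hy
      · simp [hy, hC]
      · rfl
    refine rank_lt_of_trail_eq (fun _ => rfl) (baseLevel_congr (fun _ => rfl) rfl) rfl
      (stage_congr (by rfl) hiff).le (phase_congr (by rfl) hiff).le (toLex_lt_of_lt ?_)
    have h1 := clauseWeight_resolve (h.core.wf x) he hl hr
    cases x
    · simpa [conflictWeight, Config.setConflict, hC] using h1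
    · simpa [conflictWeight, Config.setConflict, hC] using h1
  | getReason _ x C R e hC he hl hr hR =>
    have hw : ∀ b, weight Φ ((c.copyTo x R).setReason x e.lit R) b = weight Φ c b := fun b =>
      (weight_setReason ..).trans (weight_congr (fun y => copyTo_trail c x R y) b)
    have hm : ∀ y, (((c.copyTo x R).setReason x e.lit R).sol y).mode = (c.sol y).mode :=
      fun y => copyTo_mode c x R y
    have hiff : ∀ y, (((c.copyTo x R).setReason x e.lit R).sol y).conflict = none ↔
        (c.sol y).conflict = none := fun y => by
      rw [show (((c.copyTo x R).setReason x e.lit R).sol y).conflict = _ from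
        copyTo_conflict c x R y]
    have hlev : ((c.copyTo x R).setReason x e.lit R).level = c.level := copyTo_level c x R
    refine rank_lt_of_numExt (by rw [hw, baseLevel_congr hm hlev])
      (stage_congr (hm _) hiff).le (by rw [hw, hlev]) (phase_congr (hm _) hiff).le ?_
    simpa using numExt_setReason_lt (c := c.copyTo x R) R (by simpa using he) hr
  | handOver _ C hmode hC hI =>
    have ht : ∀ y, ((((c.copyTo .m C).setConflict .s none).setConflict .m (some C)).sol y).trail =
        (c.sol y).trail := fun y => copyTo_trail c .m C y
    have hm : ∀ y, ((((c.copyTo .m C).setConflict .s none).setConflict .m (some C)).sol y).mode =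
        (c.sol y).mode := fun y => copyTo_mode c .m C y
    have hl : (((c.copyTo .m C).setConflict .s none).setConflict .m (some C)).level = c.level :=
      copyTo_level c .m C
    have h1 : ((((c.copyTo .m C).setConflict .s none).setConflict .m (some C)).sol .s).conflict =
      none := rfl
    have h2 : ((((c.copyTo .m C).setConflict .s none).setConflict .m (some C)).sol .m).conflict =
      some C := rfl
    clear hc' h'
    generalize ((c.copyTo .m C).setConflict .s none).setConflict .m (some C) = d at *
    refine rank_lt_of_phase (by rw [weight_congr ht, baseLevel_congr hm hl])
      (by rw [stage_of_conflict hmode hC, stage_of_conflict ((hm .s).trans hmode) h2])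
      (by rw [weight_congr ht, hl]) ?_
    rw [phase_of_sec hC, phase_of_main h1 h2, hm, hmode]
    exact Nat.zero_lt_one
  | backjump _ C e b hmode hC ha =>
    refine rank_lt_of_base hc' ?_
    rw [baseLevel_of_normal hmode, baseLevel_of_normal (by simpa [Config.Normal] using hmode)]
    exact h.core.weight_lt_backjump h.covered _ _ _ (h.core.lt_level ha) le_rfl
  | mainSat _ hq hmode hsat =>
    refine rank_lt_of_stage ?_ ?_
    · rw [baseLevel_of_normal hmode, baseLevel_of_decide (i := c.level) rfl]
      exact le_rfl
    · rw [stage_of_quiet hmode.1 hq.1, stage_of_decide (i := c.level) rfl]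
      decide
  | speculate _ hq hmode hunit =>
    refine rank_lt_of_stage ?_ ?_
    · rw [baseLevel_of_normal hmode, baseLevel_of_decide (i := c.level) rfl]
      exact le_rfl
    · rw [stage_of_quiet hmode.1 hq.1, stage_of_decide (i := c.level) rfl]
      decide
  | secBackjump _ C e i b hmode hC ha hb =>
    have hmode' := (backjump_mode c (interface Φ) .s .s C (neg e.lit) b).trans hmode
    refine rank_lt_of_weight hc' ?_ ?_
      (h.core.weight_lt_backjump h.covered _ _ _ (h.core.lt_level ha) le_rfl)
    · rw [baseLevel_of_decide hmode, baseLevel_of_decide hmode']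
      exact h.core.weight_le_backjump h.covered _ _ _ (h.core.lt_level ha) _
    · rw [stage_of_decide hmode, stage_of_decide hmode']
  | secBlocked _ C i hmode hC hI hlev =>
    refine rank_lt_of_stage ?_ ?_
    · rw [baseLevel_of_decide hmode, baseLevel_of_normal ⟨rfl, rfl⟩]
      -- The base level is still `i`, now as the current level, and the trail up to `i` is intact.
      refine ((weight_backTo (c := ((c.copyTo .m C).setConflict .s none).setConflict .m (some C))
        le_rfl).trans ?_).ge
      exact weight_congr (fun y => copyTo_trail c .m C y) _
    · rw [stage_of_decide hmode, stage_of_conflict (x := .m) (C := C) rfl rfl]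
      decide
  | mainToSec _ C i hs hm hC hI =>
    have ht : ∀ y, ((((c.copyTo .s C).setConflict .m none).setConflict .s (some C)).sol y).trail =
        (c.sol y).trail := fun y => copyTo_trail c .s C y
    have hm' : ∀ y, ((((c.copyTo .s C).setConflict .m none).setConflict .s (some C)).sol y).mode =
        (c.sol y).mode := fun y => copyTo_mode c .s C y
    have hl : (((c.copyTo .s C).setConflict .m none).setConflict .s (some C)).level = c.level :=
      copyTo_level c .s C
    have h1 : ((((c.copyTo .s C).setConflict .m none).setConflict .s (some C)).sol .s).conflict =
      some C := rfl
    clear hc' h'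
    generalize ((c.copyTo .s C).setConflict .m none).setConflict .s (some C) = d at *
    refine rank_lt_of_phase (by rw [weight_congr ht, baseLevel_congr hm' hl])
      (by rw [stage_of_decide hs, stage_of_decide ((hm' .s).trans hs)])
      (by rw [weight_congr ht, hl]) ?_
    rw [phase_of_main (h.conflict _ _ hC).2.2 hC, phase_of_sec h1, hm', hs]
    exact Nat.zero_lt_one
  | mainBlocked _ C i hs hm hC hlev =>
    refine rank_lt_of_stage ?_ ?_
    · rw [baseLevel_of_decide hs, baseLevel_of_normal ⟨rfl, rfl⟩]
      exact (weight_backTo le_rfl).ge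
    · rw [stage_of_decide hs, stage_of_conflict
        (c := (c.backTo i).setModes .propagate (.decide 0)) (x := .m) (C := C) rfl hC]
      decide
  | secRefine _ C e i l hmode hC he hl hr hlev hR hvar =>
    refine rank_lt_of_base hc' ?_
    rw [baseLevel_of_decide hmode, baseLevel_of_normal ⟨rfl, rfl⟩]
    exact weight_lt_refine i l
  | mainRefine _ C d e i l hs hm hC hd hdC hdr hdI he heI hlev hvar =>
    refine rank_lt_of_base hc' ?_
    rw [baseLevel_of_decide hs, baseLevel_of_normal ⟨rfl, rfl⟩]
    exact weight_lt_refine i l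
  | validate _ i hq hs hm hsat =>
    refine rank_lt_of_stage ?_ ?_
    · rw [baseLevel_of_decide hs, baseLevel_of_validate (i := i) (j := c.level) rfl rfl]
      exact le_rfl
    · rw [stage_of_decide hs, stage_of_finished rfl]
      decide
  | secSat _ i hq hs hm hsat =>
    -- The target would be ⟨F, F⟩, which its invariant excludes.
    exact (h'.modes.not_finished rfl rfl).elim
  | validated _ i j hq hs hm hsat =>
    exact (h'.modes.not_finished rfl rfl).elim
  | valBackjump _ C e i j b hs hm hC ha hb =>
    have hs' := (backjump_mode c (interface Φ) .m .s C (neg e.lit) b).trans hs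
    have hm' := (backjump_mode c (interface Φ) .m .m C (neg e.lit) b).trans hm
    refine rank_lt_of_weight hc' ?_ ?_
      (h.core.weight_lt_backjump h.covered _ _ _ (h.core.lt_level ha) le_rfl)
    · rw [baseLevel_of_validate hs hm, baseLevel_of_validate hs' hm']
      exact h.core.weight_le_backjump h.covered _ _ _ (h.core.lt_level ha) _
    · rw [stage_of_finished hs, stage_of_finished hs']
  | valExit _ C e i j b hs hm hC ha hb =>
    refine rank_lt_of_base hc' ?_
    rw [baseLevel_of_validate hs hm, baseLevel_of_normal ⟨rfl, rfl⟩, weight_setModes]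
    -- The old cut-off `i` exceeds the new one `b`; the strict inequality holds for every old
    -- cut-off.
    exact h.core.weight_lt_backjump h.covered _ _ _ (h.core.lt_level ha) (le_refl b)
  | valRefine _ C e i j l hs hm hC he hl hr hlev hR hvar =>
    refine rank_lt_of_base hc' ?_
    rw [baseLevel_of_validate hs hm, baseLevel_of_normal ⟨rfl, rfl⟩]
    exact weight_lt_refine i l

end Rank

/-! ### Absence of deadlocks and conclusion -/

section Progress

variable {V : Type*} [DecidableEq V] {Φ : Idx → Cnf V} {c : Config V}

/-- The state can be continued. -/
def CanStep (Φ : Idx → Cnf V) (c : Config V) : Prop := ∃ st, Trans Φ (.run c) st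

/-- A free variable could be decided and a falsified clause taken as conflict; under a full
assignment an unfalsified clause is satisfied. -/
theorem fullSat_of_not_canStep (h : Inv Φ c) (hn : ¬ CanStep Φ c) (hq : c.Quiet) {x : Idx}
    (hmode : (∃ i, (c.sol x).mode = .decide i) ∨ ∃ i j, (c.sol x).mode = .validate i j) :
    FullSat (vars (Φ x)) (c.sol x) := by
  have hv : ∀ v ∈ vars (Φ x), ∃ e ∈ (c.sol x).trail, e.lit.1 = v := by
    intro v hv
    by_contra hno
    push Not at hno
    exact hn ⟨_, .decide c x (v, true) hq hmode hv (unassigned_iff.2 hno)⟩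
  refine ⟨hv, fun C hC => ?_⟩
  by_contra hno
  push Not at hno
  refine hn ⟨_, .conflict c x C hq hC fun l hl => ?_⟩
  obtain ⟨e, he, hel⟩ := hv l.1 (h.core.db_vars x C hC l hl)
  rcases eq_or_eq_neg hel with h' | h'
  · exact absurd ⟨e, he, h'⟩ (hno l hl)
  · exact ⟨e, he, h'⟩

theorem Inv.canStep_of_quiet (h : Inv Φ c) (hq : ∀ x, (c.sol x).conflict = none) :
    CanStep Φ c := by
  by_contra hn
  have hm := h.modes
  have hq' : ∀ x, (c.sol x).mode ≠ .finished → c.Quiet := fun x hx => ⟨hq, x, hx⟩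
  cases hm with
  | normal hm hdec =>
    have hq := hq' .s (by rw [hm.1]; simp)
    refine hn ⟨_, .speculate c hq hm fun x C hC l hu => hn ⟨_, .propagate c x C l hq ?_ hC hu⟩⟩
    cases x
    · rw [hm.1]; simp
    · rw [hm.2]; simp
  | exploring i hs hm =>
    have hq := hq' .s (by rw [hs]; simp)
    exact hn ⟨_, .secSat c i hq hs hm (fullSat_of_not_canStep h hn hq (Or.inl ⟨i, hs⟩))⟩
  | speculating i hs hm =>
    have hq := hq' .s (by rw [hs]; simp)
    exact hn ⟨_, .validate c i hq hs hm (fullSat_of_not_canStep h hn hq (Or.inl ⟨i, hs⟩))⟩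
  | validating i j hs hm =>
    have hq := hq' .m (by rw [hm]; simp)
    exact hn ⟨_, .validated c i j hq hs hm
      (fullSat_of_not_canStep h hn hq (Or.inr ⟨i, j, hm⟩))⟩

/-- An external literal has an interface reason if the other module made no decision up to its
level. -/
theorem Core.exists_interfaceReason (h : Core Φ c) {x : Idx} {e : Entry V}
    (he : e ∈ (c.sol x).trail) (hr : e.reason = .ext)
    (hdec : ∀ a ∈ (c.sol x.other).trail, a.reason = .decision → e.level < a.level) :
    ∃ R, InterfaceReason (interface Φ) (c.sol x.other).trail e.lit R := by
  obtain ⟨hI, a, ha, hal, har⟩ := h.ext x e he hr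
  obtain ⟨a', ha', hal', hlev⟩ := h.exists_shared x.other he hI
  have := (h.wf _).eq_of_var_eq ha ha' (by rw [hal, hal'])
  subst this
  cases hR : a.reason with
  | decision => exact absurd (hdec a ha hR) (by omega)
  | ext => exact absurd hR har
  | clause R =>
    rw [← hal]
    refine InterfaceReason.exists (h.wf _) ha (hal ▸ hI) hR fun b hb hbI hbl => ?_
    cases hbr : b.reason with
    | decision => exact absurd (hdec b hb hbr) (by omega)
    | ext => exact absurd (h.ext _ b hb hbr).1 hbI
    | clause R => exact ⟨R, rfl⟩

omit [DecidableEq V] in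
/-- A clause whose literals above level `n` were falsified by decisions is asserting. -/
theorem WF.exists_asserting {t : List (Entry V)} (hw : WF t) {C : Clause V} {n : ℕ}
    {d : Entry V} (hd : d ∈ t) (hdC : neg d.lit ∈ C) (hn : n < d.level)
    (hdec : ∀ e ∈ t, neg e.lit ∈ C → n < e.level → e.reason = .decision) :
    ∃ e b, Asserting t C e b ∧ n ≤ b ∧ b + 1 = e.level := by
  have hfin : {e | e ∈ t ∧ neg e.lit ∈ C}.Finite := (List.finite_toSet t).subset fun e he => he.1
  obtain ⟨e, ⟨he, heC⟩, hmax⟩ := Set.exists_max_image _ Entry.level hfin ⟨d, hd, hdC⟩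
  have hdl := hmax d ⟨hd, hdC⟩
  -- `e` has maximal level among the falsifying entries. Another one on that level would be a second
  -- decision there, so backjumping by a single level suffices.
  refine ⟨e, e.level - 1, ⟨he, heC, by omega, fun a ha haC hne => ?_⟩, by omega, by omega⟩
  have hal := hmax a ⟨ha, haC⟩
  by_contra hlt
  have hae : a.level = e.level := by omega
  exact hne (congrArg Entry.lit (hw.decision_unique ha he (hdec a ha haC (by omega))
    (hdec e he heC (by omega)) hae))

/-- In a stuck configuration Explain and Reason do not apply, so `C` is falsified by decisions and
by external literals without interface reason. The mode invariant then always leaves some other rule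
applicable. -/
theorem Inv.canStep_of_conflict (h : Inv Φ c) {x : Idx} {C : Clause V}
    (hC : (c.sol x).conflict = some C) : CanStep Φ c := by
  by_contra hn
  obtain ⟨hf, -, -⟩ := h.conflict x C hC
  have hcl : ∀ e ∈ (c.sol x).trail, neg e.lit ∈ C → ∀ R, e.reason ≠ .clause R :=
    fun e he hl R hR => hn ⟨_, .explain c x C R e hC he hl hR⟩
  have hext : ∀ e ∈ (c.sol x).trail, neg e.lit ∈ C → e.reason = .ext →
      ∀ R, ¬ InterfaceReason (interface Φ) (c.sol x.other).trail e.lit R :=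
    fun e he hl hr R hR => hn ⟨_, .getReason c x C R e hC he hl hr hR⟩
  have hcases : ∀ e ∈ (c.sol x).trail, neg e.lit ∈ C → e.reason = .ext ∨ e.reason = .decision := by
    intro e he hl
    cases hr : e.reason with
    | decision => exact Or.inr rfl
    | ext => exact Or.inl rfl
    | clause R => exact absurd hr (hcl e he hl R)
  have hentry : ∀ l ∈ C, ∃ e ∈ (c.sol x).trail, e.lit = neg l ∧ neg e.lit ∈ C := by
    intro l hl
    obtain ⟨e, he, hel⟩ := hf l hl
    exact ⟨e, he, hel, by rwa [hel, neg_neg]⟩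
  -- External literals are shared, so a local literal can only have been falsified by a decision.
  have hlocal : ¬ SharedClause (interface Φ) C → ∃ e ∈ (c.sol x).trail, neg e.lit ∈ C ∧
      e.lit.1 ∉ interface Φ ∧ e.reason = .decision := by
    intro hI
    simp only [SharedClause, not_forall] at hI
    obtain ⟨l, hl, hlI⟩ := hI
    obtain ⟨e, he, hel, heC⟩ := hentry l hl
    have heI : e.lit.1 ∉ interface Φ := by rwa [hel]
    exact ⟨e, he, heC, heI,
      (hcases e he heC).resolve_left fun hr => heI (h.core.ext x e he hr).1⟩
  -- An external literal above `i` would allow refinement. Without one, a decision makes the clause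
  -- asserting at some `b ≥ i`; with no decision either, the clause is shared and depends on levels
  -- up to `i` only.
  have hsec : ∀ i, (c.sol .s).mode = .decide i →
      (∀ e ∈ (c.sol .s).trail, e.reason = .decision → i < e.level) → x ≠ .s := by
    rintro i hs hdec rfl
    have hle : ∀ e ∈ (c.sol .s).trail, neg e.lit ∈ C → e.reason = .ext → e.level ≤ i := by
      intro e he hl hr
      by_contra hlt
      exact hn ⟨_, .secRefine c C e i e.lit hs hC he hl hr (not_le.1 hlt)
        (hext e he hl hr) rfl⟩
    by_cases hd : ∃ d ∈ (c.sol .s).trail, neg d.lit ∈ C ∧ d.reason = .decision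
    · obtain ⟨d, hd, hdC, hdr⟩ := hd
      obtain ⟨e, b, ha, hb, -⟩ := (h.core.wf .s).exists_asserting hd hdC (hdec d hd hdr)
        fun e he hl hlt => (hcases e he hl).resolve_left fun hr =>
          absurd (hle e he hl hr) (not_le.2 hlt)
      exact hn ⟨_, .secBackjump c C e i b hs hC ha hb⟩
    · push Not at hd
      have hall : ∀ e ∈ (c.sol .s).trail, neg e.lit ∈ C → e.reason = .ext := fun e he hl =>
        (hcases e he hl).resolve_right (hd e he hl)
      refine hn ⟨_, .secBlocked c C i hs hC ?_ fun e he hl => hle e he hl (hall e he hl)⟩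
      by_contra hI
      obtain ⟨e, he, hl, -, hr⟩ := hlocal hI
      exact hd e he hl hr
  have hne : x = .m → ∃ e ∈ (c.sol x).trail, neg e.lit ∈ C := by
    rintro rfl
    rcases C.eq_empty_or_nonempty with rfl | ⟨l, hl⟩
    · exact absurd ⟨_, .fail c hC⟩ hn
    · obtain ⟨e, he, -, heC⟩ := hentry l hl
      exact ⟨e, he, heC⟩
  have hm := h.modes
  cases hm with
  | normal hm hdec =>
    cases x with
    | s =>
      by_cases hI : SharedClause (interface Φ) C
      · exact hn ⟨_, .handOver c C hm.1 hC hI⟩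
      · obtain ⟨e, he, -, -, hr⟩ := hlocal hI
        exact hdec e he hr
    | m =>
      -- As `s` has made no decisions, every external literal of `m` has an interface reason; only
      -- decisions remain.
      have hall : ∀ e ∈ (c.sol .m).trail, neg e.lit ∈ C → e.reason = .decision :=
        fun e he hl => (hcases e he hl).resolve_left fun hr => by
          obtain ⟨R, hR⟩ := h.core.exists_interfaceReason he hr fun a ha had =>
            absurd had (hdec a ha)
          exact hext e he hl hr R hR
      obtain ⟨d, hd, hdC⟩ := hne rfl
      obtain ⟨e, b, ha, -, -⟩ := (h.core.wf .m).exists_asserting hd hdC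
        ((h.core.wf .m).decision_pos hd (hall d hd hdC)) fun e he hl _ => hall e he hl
      exact hn ⟨_, .backjump c C e b hm hC ha⟩
  | exploring i hs hm hi hdec hlev hsat hconf =>
    cases x with
    | s => exact hsec i hs hdec rfl
    | m => rw [hC] at hconf; cases hconf
  | speculating i hs hm hi hdec hdec' =>
    cases x with
    | s => exact hsec i hs hdec rfl
    | m =>
      by_cases hlev : LevelsLE (c.sol .m).trail C i
      · exact hn ⟨_, .mainBlocked c C i hs hm hC hlev⟩
      by_cases hI : SharedClause (interface Φ) C
      · exact hn ⟨_, .mainToSec c C i hs hm hC hI⟩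
      simp only [LevelsLE, not_forall] at hlev
      obtain ⟨e, he, hl, hlt⟩ := hlev
      -- During speculation `m` has no decisions above `i`, so this literal is external, and its
      -- shared variable serves for the refinement.
      have hr := (hcases e he hl).resolve_right fun hr => hlt (hdec' e he hr)
      have heI := (h.core.ext .m e he hr).1
      obtain ⟨a, ha, hal, hal'⟩ := h.core.exists_shared .s he heI
      obtain ⟨d, hd, hdC, hdI, hdr⟩ := hlocal hI
      exact hn ⟨_, .mainRefine c C d a i a.lit hs hm hC hd hdC hdr hdI ha (hal ▸ heI)
        (by omega) rfl⟩
  | validating i j hs hm hi hj hdec hdec' hlev hsat hconf =>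
    cases x with
    | s => rw [hC] at hconf; cases hconf
    | m =>
      -- External literals above `i` would allow refinement; up to `i` they have interface reasons,
      -- because `s` decides only above `i`.
      have hall : ∀ e ∈ (c.sol .m).trail, neg e.lit ∈ C → e.reason = .decision := by
        refine fun e he hl => (hcases e he hl).resolve_left fun hr => ?_
        by_cases hlt : i < e.level
        · exact hn ⟨_, .valRefine c C e i j e.lit hs hm hC he hl hr hlt (hext e he hl hr) rfl⟩
        · obtain ⟨R, hR⟩ := h.core.exists_interfaceReason he hr fun a ha had =>
            (not_lt.1 hlt).trans_lt (hdec a ha had)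
          exact hext e he hl hr R hR
      by_cases hlev : LevelsLE (c.sol .m).trail C j
      · obtain ⟨d, hd, hdC⟩ := hne rfl
        obtain ⟨e, b, ha, -, hb⟩ := (h.core.wf .m).exists_asserting hd hdC
          ((h.core.wf .m).decision_pos hd (hall d hd hdC)) fun e he hl _ => hall e he hl
        -- No decision of `m` has a level in `(i, j]`, so this one has level at most `i`, and `b`,
        -- one less, is below `i`.
        have h1 := hdec' e ha.1 (hall e ha.1 ha.2.1)
        have h2 := hlev e ha.1 ha.2.1
        exact hn ⟨_, .valExit c C e i j b hs hm hC ha (by omega)⟩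
      · simp only [LevelsLE, not_forall] at hlev
        obtain ⟨d, hd, hdC, hlt⟩ := hlev
        obtain ⟨e, b, ha, hb, -⟩ := (h.core.wf .m).exists_asserting hd hdC (not_le.1 hlt)
          fun e he hl _ => hall e he hl
        exact hn ⟨_, .valBackjump c C e i j b hs hm hC ha hb⟩

theorem Inv.canStep (h : Inv Φ c) : CanStep Φ c := by
  by_cases hq : ∀ x, (c.sol x).conflict = none
  · exact h.canStep_of_quiet hq
  · push Not at hq
    obtain ⟨x, hx⟩ := hq
    obtain ⟨C, hC⟩ := Option.ne_none_iff_exists'.1 hx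
    exact h.canStep_of_conflict hC

theorem not_exists_run (hunsat : ¬ ∃ τ : V → Bool, (Φ .s).SatBy τ ∧ (Φ .m).SatBy τ) :
    ¬ ∃ run : ℕ → State V, run 0 = start Φ ∧ ∀ n, Trans Φ (run n) (run (n + 1)) := by
  rintro ⟨run, h0, hrun⟩
  have hconf : ∀ n, ∃ c, run n = .run c := by
    intro n
    have := hrun n
    generalize run n = st at this
    cases st with
    | run c => exact ⟨c, rfl⟩
    | unsat π => cases this
  choose c hc using hconf
  have hstep : ∀ n, Trans Φ (.run (c n)) (.run (c (n + 1))) := fun n => by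
    rw [← hc, ← hc]
    exact hrun n
  have hinv : ∀ n, Inv Φ (c n) := by
    intro n
    induction n with
    | zero => exact Inv.start Φ _ (by rw [← h0, hc])
    | succ n ih => exact ih.step hunsat (hstep n)
  exact not_strictAnti_of_wellFoundedLT (fun n => rank Φ (c n))
    (strictAnti_nat_of_succ_lt fun n => (hinv n).rank_lt (hinv (n + 1)) (hstep n))

theorem inv_of_reachable (hunsat : ¬ ∃ τ : V → Bool, (Φ .s).SatBy τ ∧ (Φ .m).SatBy τ)
    {st : State V} (h : Relation.ReflTransGen (Trans Φ) (start Φ) st) :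
    (∃ c, st = .run c ∧ Inv Φ c) ∨ ∃ π, st = .unsat π ∧ IsModularDRUPProofOf π Φ := by
  induction h with
  | refl => exact Or.inl ⟨_, rfl, Inv.start Φ _ rfl⟩
  | @tail st st' _ ht ih =>
    rcases ih with ⟨c, rfl, hc⟩ | ⟨π, rfl, -⟩
    · cases st' with
      | run c' => exact Or.inl ⟨c', rfl, hc.step hunsat ht⟩
      | unsat π => exact Or.inr ⟨π, rfl, hc.unsat_log ht⟩
    · cases ht

end Progress

end SpecSMS

/-- If `Φ s ∧ Φ m` is unsatisfiable, then SpecSMS has no infinite execution, and every execution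
that cannot be continued has reached `unsat` and has logged a valid modular DRUP proof of
unsatisfiability of `Φ s ∧ Φ m`. -/
theorem mainTheorem4 {V : Type*} [DecidableEq V] (Φ : SpecSMS.Idx → SpecSMS.Cnf V)
    (hunsat : ¬ ∃ τ : V → Bool, (Φ .s).SatBy τ ∧ (Φ .m).SatBy τ) :
    (¬ ∃ run : ℕ → SpecSMS.State V,
      run 0 = SpecSMS.start Φ ∧ ∀ n, SpecSMS.Trans Φ (run n) (run (n + 1))) ∧
    ∀ st : SpecSMS.State V,
      Relation.ReflTransGen (SpecSMS.Trans Φ) (SpecSMS.start Φ) st →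
      (∀ st', ¬ SpecSMS.Trans Φ st st') →
      ∃ π, st = .unsat π ∧ SpecSMS.IsModularDRUPProofOf π Φ := by
  refine ⟨SpecSMS.not_exists_run hunsat, fun st hst hstuck => ?_⟩
  rcases SpecSMS.inv_of_reachable hunsat hst with ⟨c, rfl, hc⟩ | h
  · obtain ⟨st', ht⟩ := hc.canStep
    exact absurd ht (hstuck st')
  · exact h
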